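/- Let $X$ be a compact geodesic metric space that is unloopable (path-connected, locally path-connected and semi-locally simply connected), let $* \in X$, and suppose that $G=\pi_1(X,*)$ is residually finite. Let $(\widetilde X,*)\to(X,*)$ be a pointed universal cover, with its left action of $G$ by deck transformations and with the length metric $d$ induced from $X$ (the distance of two points is the infimum of the lengths in $X$ of the projections of paths joining them). For a finite-index subgroup $H\le G$ put $X_H=H\backslash\widetilde X$, and let $\mathcal S(X)=\varprojlim_{H} X_H$, over all $H\le G$ of finite index, be the full solenoid, pointed by the image of $*$ under the canonical map $\ell\colon\widetilde X\to\mathcal S(X)$, whose image is called the baseleaf. Let $\mathrm{HE}(\mathcal S(X),*)$ be the monoid of pointed homotopy equivalences of $(\mathcal S(X),*)$ to itself, and $\mathrm{HMod}(\mathcal S(X),*)$ the group of their pointed homotopy classes, under composition. For a metric space $Y$ let $\mathrm{QI}(Y)$ be the group of quasi-isometries $Y\to Y$ modulo bounded distance. Then: 1. For every $f\in\mathrm{HE}(\mathcal S(X),*)$ there is a unique map $f_{\widetilde X}\colon\widetilde X\to\widetilde X$ with $\ell\circ f_{\widetilde X}=f\circ\ell$, and it is a quasi-isometry of $(\widetilde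 X,d)$. 2. The rule $[f]\mapsto[f_{\widetilde X}]$ gives a well-defined group homomorphism $Q\colon\mathrm{HMod}(\mathcal S(X),*)\to\mathrm{QI}(\widetilde X)$. 3. $G$ is finitely generated and, for the word metric on $G$ of any finite generating set, the orbit map $o\colon G\to\widetilde X$, $g\mapsto g\cdot *$, induces a group isomorphism $\Phi\colon\mathrm{QI}(\widetilde X)\cong\mathrm{QI}(G)$: for quasi-isometries $a$ of $\widetilde X$ and $b$ of $G$, $\Phi[a]=[b]$ if and only if $a\circ o$ and $o\circ b$ are at bounded distance. Hence $\Phi\circ Q$ is a group homomorphism $\mathrm{HMod}(\mathcal S(X),*)\to\mathrm{QI}(G)$. -/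

import Mathlib

open scoped ENNReal NNReal unitInterval

universe u v w

noncomputable section

/-! ### Unloopable spaces and geodesic metric spaces -/

/-- Every point `x` has a neighbourhood `V` such that each loop in `V` is null-homotopic in `X`. -/
def IsSemilocallySimplyConnected (X : Type u) [TopologicalSpace X] : Prop :=
  ∀ x : X, ∃ V ∈ nhds x, ∀ (y : X) (γ : Path y y), (∀ t, γ t ∈ V) →
    Path.Homotopic γ (Path.refl y)

/-- Path-connected, locally path-connected and semi-locally simply connected spaces. -/
structure IsUnloopable (X : Type u) [TopologicalSpace X] : Prop where
  pathConnected : PathConnectedSpace X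
  locallyPathConnected : LocallyPathConnectedSpace X
  semilocallySimplyConnected : IsSemilocallySimplyConnected X

/-- Any two points are joined by a geodesic segment. -/
def IsGeodesicMetricSpace (X : Type u) [MetricSpace X] : Prop :=
  ∀ x y : X, ∃ γ : ℝ → X, γ 0 = x ∧ γ (dist x y) = y ∧
    ∀ s ∈ Set.Icc 0 (dist x y), ∀ t ∈ Set.Icc 0 (dist x y), dist (γ s) (γ t) = |s - t|

/-! ### Pointed universal covers and the action of the fundamental group -/

/-- A pointed universal cover of `(X, x₀)`. -/
structure UniversalCover (X : Type u) [TopologicalSpace X] (x₀ : X) where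
  /-- the total space -/
  Space : Type v
  [topology : TopologicalSpace Space]
  [simplyConnected : SimplyConnectedSpace Space]
  /-- the covering map -/
  proj : Space → X
  isCoveringMap : IsCoveringMap proj
  /-- the base point -/
  base : Space
  proj_base : proj base = x₀

namespace UniversalCover

attribute [instance] UniversalCover.topology UniversalCover.simplyConnected

section Action

variable {X : Type u} [TopologicalSpace X] {x₀ : X} (U : UniversalCover.{u, v} X x₀)

/-- The base point as a point of the fibre over `x₀`. -/
def fibreBase : U.proj ⁻¹' {x₀} := ⟨U.base, U.proj_base⟩

/-- The class in `X` of the image of the (up to homotopy unique) path in the universal cover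
from the base point to `x`. -/
def pathTo (x : U.Space) : Path.Homotopic.Quotient x₀ (U.proj x) :=
  (Path.Homotopic.Quotient.map (Path.Homotopic.Quotient.mk (PathConnectedSpace.somePath U.base x))
    ⟨U.proj, U.isCoveringMap.continuous⟩).cast U.proj_base.symm rfl

theorem monodromy_pathTo (x : U.Space) :
    U.isCoveringMap.monodromy (U.pathTo x) U.fibreBase = ⟨x, rfl⟩ := by
  apply U.isCoveringMap.monodromy_eq_of_map_eq (ex := U.fibreBase) (ey := ⟨x, rfl⟩)
    (Path.Homotopic.Quotient.mk (PathConnectedSpace.somePath U.base x))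
  rfl

theorem pathTo_eq (x : U.Space) (γ : Path.Homotopic.Quotient x₀ (U.proj x))
    (h : U.isCoveringMap.monodromy γ U.fibreBase = ⟨x, rfl⟩) : U.pathTo x = γ := by
  have h1 := U.isCoveringMap.map_liftPathQuotient γ U.fibreBase
  have h3 : ∀ (z : U.proj ⁻¹' {U.proj x}) (δ : Path.Homotopic.Quotient U.base z.1),
      z = ⟨x, rfl⟩ →
      Path.Homotopic.Quotient.map δ ⟨U.proj, U.isCoveringMap.continuous⟩ =
        γ.cast U.proj_base z.2 → U.pathTo x = γ := by
    rintro z δ rfl hz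
    have h4 : Path.Homotopic.Quotient.mk (PathConnectedSpace.somePath U.base x) = δ :=
      Subsingleton.elim _ _
    unfold pathTo
    rw [h4, hz]
    clear hz h4 h h1
    obtain ⟨γ⟩ := γ
    rfl
  exact h3 _ _ h h1

/-- The left action of the fundamental group on the universal cover by deck transformations:
`g • x` is the end of the lift, starting at the base point, of a loop representing `g⁻¹` followed
by the projection of a path from the base point to `x`. (The product `g * h` in Mathlib's
fundamental group is "first `h`, then `g`", so the inverse makes this a left action; the
identification with the group whose product is "first `g`, then `h`" is `g ↦ g⁻¹`.) -/
instance : MulAction (FundamentalGroup X x₀) U.Space where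
  smul g x := (U.isCoveringMap.monodromy
    (Path.Homotopic.Quotient.trans (FundamentalGroup.toPath g⁻¹) (U.pathTo x)) U.fibreBase).1
  one_smul x := by
    change (U.isCoveringMap.monodromy (Path.Homotopic.Quotient.trans
      (FundamentalGroup.toPath (1 : FundamentalGroup X x₀)⁻¹) (U.pathTo x)) U.fibreBase).1 = x
    rw [U.isCoveringMap.monodromy_trans_apply, inv_one]
    have : FundamentalGroup.toPath (1 : FundamentalGroup X x₀) =
      Path.Homotopic.Quotient.refl x₀ := rfl
    rw [this, U.isCoveringMap.monodromy_refl, id, U.monodromy_pathTo]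
  mul_smul g h x := by
    change (U.isCoveringMap.monodromy (Path.Homotopic.Quotient.trans
      (FundamentalGroup.toPath (g * h)⁻¹) (U.pathTo x)) U.fibreBase).1 =
      (U.isCoveringMap.monodromy (Path.Homotopic.Quotient.trans (FundamentalGroup.toPath g⁻¹)
        (U.pathTo (U.isCoveringMap.monodromy (Path.Homotopic.Quotient.trans
          (FundamentalGroup.toPath h⁻¹) (U.pathTo x)) U.fibreBase).1)) U.fibreBase).1
    set δ := Path.Homotopic.Quotient.trans (FundamentalGroup.toPath h⁻¹) (U.pathTo x) with hδ
    have key : ∀ (z : U.proj ⁻¹' {U.proj x}), U.isCoveringMap.monodromy δ U.fibreBase = z →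
        (U.isCoveringMap.monodromy (Path.Homotopic.Quotient.trans (FundamentalGroup.toPath g⁻¹)
          (U.pathTo z.1)) U.fibreBase).1 =
        (U.isCoveringMap.monodromy (Path.Homotopic.Quotient.trans (FundamentalGroup.toPath g⁻¹)
          δ) U.fibreBase).1 := by
      rintro ⟨z, hz⟩ h1
      have hz' : U.proj z = U.proj x := hz
      have h2 : U.pathTo z = δ.cast rfl hz' := by
        apply U.pathTo_eq
        clear_value δ
        have aux : ∀ (y : X) (hy : U.proj z = y) (ε : Path.Homotopic.Quotient x₀ y),
            U.isCoveringMap.monodromy ε U.fibreBase = ⟨z, hy⟩ →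
            U.isCoveringMap.monodromy (ε.cast rfl hy) U.fibreBase = ⟨z, rfl⟩ := by
          rintro y rfl ε hε
          simpa using hε
        exact aux _ hz' δ h1
      rw [h2]
      clear_value δ
      have aux : ∀ (y : X) (hy : U.proj z = y) (ε : Path.Homotopic.Quotient x₀ y),
          (U.isCoveringMap.monodromy (Path.Homotopic.Quotient.trans
            (FundamentalGroup.toPath g⁻¹) (ε.cast rfl hy)) U.fibreBase).1 =
          (U.isCoveringMap.monodromy (Path.Homotopic.Quotient.trans
            (FundamentalGroup.toPath g⁻¹) ε) U.fibreBase).1 := by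
        rintro y rfl ε
        simp
      exact aux _ hz' δ
    rw [key _ rfl, hδ]
    simp only [U.isCoveringMap.monodromy_trans_apply]
    rw [mul_inv_rev, FundamentalGroup.mul_def]
    exact congrArg (fun z => (U.isCoveringMap.monodromy (U.pathTo x) z).1)
      (U.isCoveringMap.monodromy_trans_apply _ _ _)

/-! ### The full solenoid and its baseleaf -/

/-- The cover `X_H = H \ X̃`, with the quotient topology. -/
def IntermediateCover (H : Subgroup (FundamentalGroup X x₀)) : Type v :=
  Quotient (MulAction.orbitRel H U.Space)

instance (H : Subgroup (FundamentalGroup X x₀)) : TopologicalSpace (U.IntermediateCover H) :=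
  inferInstanceAs (TopologicalSpace (Quotient (MulAction.orbitRel H U.Space)))

/-- The covering map `X̃ → X_H`. -/
def toCover (H : Subgroup (FundamentalGroup X x₀)) (x : U.Space) : U.IntermediateCover H :=
  Quotient.mk (MulAction.orbitRel H U.Space) x

/-- The covering map `X_H → X_K` for `H ≤ K`. -/
def bonding {H K : Subgroup (FundamentalGroup X x₀)} (h : H ≤ K) :
    U.IntermediateCover H → U.IntermediateCover K :=
  Quotient.map id (by
    rintro a b ⟨k, hk⟩
    exact ⟨⟨k.1, h k.2⟩, hk⟩)

/-- The full solenoid: the inverse limit of the covers `X_H` over all subgroups `H` of finite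
index. -/
def Solenoid : Type (max u v) :=
  {z : (H : {H : Subgroup (FundamentalGroup X x₀) // H.FiniteIndex}) → U.IntermediateCover H.1 //
    ∀ (H K : {H : Subgroup (FundamentalGroup X x₀) // H.FiniteIndex}) (h : H.1 ≤ K.1),
      U.bonding h (z H) = z K}

instance : TopologicalSpace U.Solenoid := instTopologicalSpaceSubtype

/-- The canonical map from the universal cover to the solenoid, with image the baseleaf. -/
def baseleafMap (x : U.Space) : U.Solenoid :=
  ⟨fun H => U.toCover H.1 x, fun _ _ _ => rfl⟩

/-- The base point of the solenoid. -/
def solenoidBase : U.Solenoid := U.baseleafMap U.base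

/-- `r` is the restriction of `f` to the baseleaf, under the identification of the universal cover
with the baseleaf. -/
def IsBaseleafRestriction (f : U.Solenoid → U.Solenoid) (r : U.Space → U.Space) : Prop :=
  ∀ x, U.baseleafMap (r x) = f (U.baseleafMap x)

end Action

end UniversalCover

/-! ### The length metric on the universal cover -/

/-- The length of a curve. -/
def curveLength {X : Type u} [PseudoEMetricSpace X] (c : I → X) : ℝ≥0∞ :=
  eVariationOn c Set.univ

theorem curveLength_symm_le {X : Type u} [PseudoEMetricSpace X] (c : I → X) :
    curveLength (c ∘ unitInterval.symm) ≤ curveLength c :=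
  eVariationOn.comp_le_of_antitoneOn c _
    (fun _ _ _ _ h => unitInterval.symm_le_symm.2 h) (fun _ _ => Set.mem_univ _)

theorem curveLength_trans_le {X : Type u} {E : Type v} [PseudoEMetricSpace X] [TopologicalSpace E]
    (p : E → X) {x y z : E} (γ : Path x y) (δ : Path y z) :
    curveLength (p ∘ γ.trans δ) ≤ curveLength (p ∘ γ) + curveLength (p ∘ δ) := by
  have hh : (1 / 2 : ℝ) ∈ I := ⟨by norm_num, by norm_num⟩
  set m : I := ⟨1 / 2, hh⟩
  have hsplit : curveLength (p ∘ γ.trans δ) =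
      eVariationOn (p ∘ γ.trans δ) (Set.Iic m) + eVariationOn (p ∘ γ.trans δ) (Set.Ici m) := by
    unfold curveLength
    rw [← Set.Iic_union_Ici (a := m)]
    exact eVariationOn.union _ isGreatest_Iic isLeast_Ici
  rw [hsplit]
  gcongr
  · have : Set.EqOn (p ∘ γ.trans δ)
        ((p ∘ γ) ∘ fun t : I => Set.projIcc (0 : ℝ) 1 zero_le_one (2 * t)) (Set.Iic m) := by
      intro t ht
      have ht' : (t : ℝ) ≤ 1 / 2 := ht
      simp only [Function.comp, Path.trans_apply, ht', dif_pos]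
      congr 2
      rw [Set.projIcc_of_mem]
    rw [eVariationOn.congr this]
    exact eVariationOn.comp_le_of_monotoneOn _ _
      (fun a _ b _ hab => Set.monotone_projIcc _ (by
        have : (a : ℝ) ≤ b := hab
        linarith)) (fun _ _ => Set.mem_univ _)
  · have : Set.EqOn (p ∘ γ.trans δ)
        ((p ∘ δ) ∘ fun t : I => Set.projIcc (0 : ℝ) 1 zero_le_one (2 * t - 1)) (Set.Ici m) := by
      intro t ht
      have ht' : 1 / 2 ≤ (t : ℝ) := ht
      by_cases h2 : (t : ℝ) ≤ 1 / 2
      · have h3 : (t : ℝ) = 1 / 2 := le_antisymm h2 ht'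
        have h4 : t = m := Subtype.ext h3
        subst h4
        simp only [Function.comp, Path.trans_apply, h2, dif_pos]
        congr 1
        rw [Set.projIcc_of_le_left _ (by simp [m])]
        have : (⟨2 * (m : ℝ), by simp [m]⟩ : I) = 1 := Subtype.ext (by simp [m])
        rw [this, γ.target]
        exact δ.source.symm
      · simp only [Function.comp, Path.trans_apply, h2, dif_neg, not_false_eq_true]
        congr 2
        rw [Set.projIcc_of_mem]
    rw [eVariationOn.congr this]
    exact eVariationOn.comp_le_of_monotoneOn _ _
      (fun a _ b _ hab => Set.monotone_projIcc _ (by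
        have : (a : ℝ) ≤ b := hab
        linarith)) (fun _ _ => Set.mem_univ _)

namespace UniversalCover

/-- The universal cover as a metric object, kept apart from its topology. -/
def Metrized {X : Type u} [TopologicalSpace X] {x₀ : X} (U : UniversalCover.{u, v} X x₀) : Type v :=
  U.Space

/-- The length (pseudo-, extended) metric on the universal cover: the infimum of the lengths in `X`
of the projections of the paths joining two points. -/
instance {X : Type u} [PseudoEMetricSpace X] {x₀ : X} (U : UniversalCover.{u, v} X x₀) :
    PseudoEMetricSpace U.Metrized where
  edist (x y : U.Space) := ⨅ γ : Path x y, curveLength (U.proj ∘ γ)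
  edist_self (x : U.Space) := by
    refine le_antisymm (iInf_le_of_le (Path.refl x) ?_) zero_le
    exact (eVariationOn.constant_on (by
      rintro _ ⟨_, _, rfl⟩ _ ⟨_, _, rfl⟩
      rfl)).le
  edist_comm := by
    have key : ∀ x y : U.Space, (⨅ γ : Path x y, curveLength (U.proj ∘ γ)) ≤
        ⨅ γ : Path y x, curveLength (U.proj ∘ γ) := fun x y =>
      le_iInf fun γ => iInf_le_of_le γ.symm (curveLength_symm_le (U.proj ∘ γ))
    exact fun x y => le_antisymm (key x y) (key y x)
  edist_triangle (x y z : U.Space) := by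
    refine ENNReal.le_iInf_add_iInf ?_
    intro γ δ
    exact iInf_le_of_le (γ.trans δ) (curveLength_trans_le U.proj γ δ)

end UniversalCover

/-! ### Word metrics -/

/-- A group with the word metric of a subset `S`. -/
def WordMetrized {G : Type u} [Group G] (_S : Set G) : Type u := G

/-- The least length of a word in `S ∪ S⁻¹` with value `g`; it is `∞` if there is no such word. -/
def wordLength {G : Type u} [Group G] (S : Set G) (g : G) : ℝ≥0∞ :=
  ⨅ l : {l : List G // (∀ s ∈ l, s ∈ S ∨ s⁻¹ ∈ S) ∧ l.prod = g}, (l.1.length : ℝ≥0∞)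

theorem wordLength_inv_le {G : Type u} [Group G] (S : Set G) (g : G) :
    wordLength S g⁻¹ ≤ wordLength S g := by
  refine le_iInf fun l => ?_
  refine iInf_le_of_le ⟨(l.1.map (·⁻¹)).reverse, ?_, ?_⟩ (by simp)
  · intro s hs
    simp only [List.mem_reverse, List.mem_map] at hs
    obtain ⟨t, ht, rfl⟩ := hs
    rw [inv_inv]
    exact (l.2.1 t ht).symm
  · rw [← List.prod_inv_reverse, l.2.2]

/-- The word metric `d(g, h) = |g⁻¹ h|`. -/
instance {G : Type u} [Group G] (S : Set G) : PseudoEMetricSpace (WordMetrized S) where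
  edist (g h : G) := wordLength S (g⁻¹ * h)
  edist_self (g : G) := by
    refine le_antisymm (iInf_le_of_le ⟨[], by simp, by simp⟩ (by simp)) zero_le
  edist_comm := by
    have key : ∀ g h : G, wordLength S (g⁻¹ * h) ≤ wordLength S (h⁻¹ * g) := fun g h => by
      have := wordLength_inv_le S (h⁻¹ * g)
      rwa [mul_inv_rev, inv_inv] at this
    exact fun g h => le_antisymm (key g h) (key h g)
  edist_triangle (g h k : G) := by
    refine ENNReal.le_iInf_add_iInf ?_
    intro l m
    refine iInf_le_of_le ⟨l.1 ++ m.1, ?_, ?_⟩ (by simp)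
    · intro s hs
      rcases List.mem_append.1 hs with hs | hs
      exacts [l.2.1 s hs, m.2.1 s hs]
    · rw [List.prod_append, l.2.2, m.2.2]
      group

/-- The orbit map `g ↦ g • *` from the fundamental group to the universal cover. -/
def UniversalCover.orbitMap {X : Type u} [TopologicalSpace X] {x₀ : X}
    (U : UniversalCover.{u, v} X x₀) (S : Set (FundamentalGroup X x₀)) :
    WordMetrized S → U.Metrized :=
  fun g => ((show FundamentalGroup X x₀ from g) • U.base : U.Space)

/-! ### Quasi-isometries and the quasi-isometry group -/

/-- `f` is a quasi-isometry: for some `K ≥ 1` and `C > 0`,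
`d(x, y) / K - C ≤ d(f x, f y) ≤ K d(x, y) + C`, and every point is within `C` of the image. -/
def IsQuasiIsometry {α : Type u} {β : Type v} [PseudoEMetricSpace α] [PseudoEMetricSpace β]
    (f : α → β) : Prop :=
  ∃ K C : ℝ≥0, 1 ≤ K ∧ 0 < C ∧
    (∀ x y : α, edist x y / K ≤ edist (f x) (f y) + C) ∧
    (∀ x y : α, edist (f x) (f y) ≤ K * edist x y + C) ∧
    ∀ y : β, ∃ x : α, edist (f x) y ≤ C

/-- Two maps are at bounded distance. -/
def AtBoundedDistance {α : Type u} {β : Type v} [PseudoEMetricSpace β] (f g : α → β) : Prop :=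
  ∃ D : ℝ≥0, ∀ x : α, edist (f x) (g x) ≤ D

theorem AtBoundedDistance.equivalence {α : Type u} {β : Type v} [PseudoEMetricSpace β] :
    Equivalence (AtBoundedDistance (α := α) (β := β)) where
  refl f := ⟨0, fun x => by simp⟩
  symm := fun ⟨D, h⟩ => ⟨D, fun x => by rw [edist_comm]; exact h x⟩
  trans := fun ⟨D, h⟩ ⟨D', h'⟩ => ⟨D + D', fun x => by
    push_cast
    exact (edist_triangle _ _ _).trans (add_le_add (h x) (h' x))⟩

theorem IsQuasiIsometry.id {α : Type u} [PseudoEMetricSpace α] :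
    IsQuasiIsometry (fun x : α => x) :=
  ⟨1, 1, le_rfl, one_pos, fun x y => by simp, fun x y => by simp, fun y => ⟨y, by simp⟩⟩

theorem IsQuasiIsometry.le_mul {α : Type u} {β : Type v} [PseudoEMetricSpace α]
    [PseudoEMetricSpace β] {f : α → β} {K C : ℝ≥0} (hK : 1 ≤ K)
    (h : ∀ x y : α, edist x y / K ≤ edist (f x) (f y) + C) (x y : α) :
    edist x y ≤ K * (edist (f x) (f y) + C) := by
  have hK0 : (K : ℝ≥0∞) ≠ 0 := by
    have : K ≠ 0 := (zero_lt_one.trans_le hK).ne'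
    exact_mod_cast this
  have := h x y
  rw [ENNReal.div_le_iff hK0 ENNReal.coe_ne_top] at this
  rwa [mul_comm]

theorem IsQuasiIsometry.mk' {α : Type u} {β : Type v} [PseudoEMetricSpace α]
    [PseudoEMetricSpace β] {f : α → β} (K A B C : ℝ≥0)
    (h1 : ∀ x y : α, edist x y ≤ K * edist (f x) (f y) + A)
    (h2 : ∀ x y : α, edist (f x) (f y) ≤ K * edist x y + B)
    (h3 : ∀ y : β, ∃ x : α, edist (f x) y ≤ C) : IsQuasiIsometry f := by
  refine ⟨K + 1, A + B + C + 1, by simp, by positivity, fun x y => ?_, fun x y => ?_, fun y => ?_⟩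
  · have hK0 : ((K + 1 : ℝ≥0) : ℝ≥0∞) ≠ 0 := by positivity
    rw [ENNReal.div_le_iff hK0 ENNReal.coe_ne_top]
    refine (h1 x y).trans ?_
    push_cast
    calc (K : ℝ≥0∞) * edist (f x) (f y) + A
        ≤ (edist (f x) (f y) * (K + 1)) + (A + B + C + 1) * 1 := by
          rw [mul_one, mul_comm]
          gcongr
          · exact le_self_add
          · rw [add_assoc, add_assoc]; exact le_self_add
      _ ≤ (edist (f x) (f y) * (K + 1)) + (A + B + C + 1) * (K + 1) := by
          gcongr
          exact le_add_self
      _ = _ := by ring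
  · refine (h2 x y).trans ?_
    push_cast
    gcongr
    · exact le_self_add
    · calc (B : ℝ≥0∞) ≤ B + (A + C + 1) := le_self_add
        _ = _ := by ring
  · obtain ⟨x, hx⟩ := h3 y
    refine ⟨x, hx.trans ?_⟩
    push_cast
    calc (C : ℝ≥0∞) ≤ C + (A + B + 1) := le_self_add
      _ = _ := by ring

theorem IsQuasiIsometry.comp {α : Type u} {β : Type v} {δ : Type w} [PseudoEMetricSpace α]
    [PseudoEMetricSpace β] [PseudoEMetricSpace δ] {g : β → δ} {f : α → β}
    (hg : IsQuasiIsometry g) (hf : IsQuasiIsometry f) : IsQuasiIsometry (fun x => g (f x)) := by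
  obtain ⟨K, C, hK, -, h1, h2, h3⟩ := hf
  obtain ⟨L, D, hL, -, k1, k2, k3⟩ := hg
  refine IsQuasiIsometry.mk' (K * L) (K * (L * D + C)) (L * C + D) (L * C + D + D)
    (fun x y => ?_) (fun x y => ?_) (fun z => ?_)
  · calc edist x y ≤ K * (edist (f x) (f y) + C) := IsQuasiIsometry.le_mul hK h1 x y
      _ ≤ K * (L * (edist (g (f x)) (g (f y)) + D) + C) := by
          gcongr
          exact IsQuasiIsometry.le_mul hL k1 _ _
      _ = _ := by push_cast; ring
  · calc edist (g (f x)) (g (f y)) ≤ L * edist (f x) (f y) + D := k2 _ _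
      _ ≤ L * (K * edist x y + C) + D := by
          gcongr
          exact h2 x y
      _ = _ := by push_cast; ring
  · obtain ⟨y, hy⟩ := k3 z
    obtain ⟨x, hx⟩ := h3 y
    refine ⟨x, (edist_triangle _ (g y) _).trans ?_⟩
    push_cast
    refine add_le_add ((k2 _ _).trans ?_) hy
    gcongr

theorem IsQuasiIsometry.exists_inverse {α : Type u} {β : Type v} [PseudoEMetricSpace α]
    [PseudoEMetricSpace β] {f : α → β} (hf : IsQuasiIsometry f) :
    ∃ g : β → α, IsQuasiIsometry g ∧ AtBoundedDistance (fun x => g (f x)) (fun x => x) ∧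
      AtBoundedDistance (fun y => f (g y)) (fun y => y) := by
  obtain ⟨K, C, hK, -, h1, h2, h3⟩ := hf
  choose g hg using h3
  have hgf : ∀ x, edist (g (f x)) x ≤ (K * (C + C) : ℝ≥0) := fun x => by
    refine (IsQuasiIsometry.le_mul hK h1 _ _).trans ?_
    push_cast
    gcongr
    exact hg (f x)
  refine ⟨g, ?_, ⟨_, hgf⟩, ⟨C, hg⟩⟩
  have hfg : ∀ y y', edist (f (g y)) (f (g y')) ≤ edist y y' + (C + C) := fun y y' => by
    calc edist (f (g y)) (f (g y'))
        ≤ edist (f (g y)) y + edist y y' + edist y' (f (g y')) := edist_triangle4 _ _ _ _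
      _ ≤ C + edist y y' + C := by
          gcongr
          · exact hg y
          · rw [edist_comm]; exact hg y'
      _ = _ := by ring
  refine IsQuasiIsometry.mk' K (C + C + C) (K * (C + C + C)) (K * (C + C))
    (fun y y' => ?_) (fun y y' => ?_) (fun x => ⟨f x, hgf x⟩)
  · calc edist y y' ≤ edist y (f (g y)) + edist (f (g y)) (f (g y')) + edist (f (g y')) y' :=
          edist_triangle4 _ _ _ _
      _ ≤ C + (K * edist (g y) (g y') + C) + C := by
          gcongr
          · rw [edist_comm]; exact hg y
          · exact h2 _ _
          · exact hg y'
      _ = _ := by push_cast; ring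
  · calc edist (g y) (g y') ≤ K * (edist (f (g y)) (f (g y')) + C) :=
          IsQuasiIsometry.le_mul hK h1 _ _
      _ ≤ K * ((edist y y' + (C + C)) + C) := by
          gcongr
          exact hfg y y'
      _ = _ := by push_cast; ring

/-- The monoid of quasi-isometries of a space to itself, under composition. -/
def QIMaps (α : Type u) [PseudoEMetricSpace α] : Submonoid (Function.End α) where
  carrier := {f | IsQuasiIsometry (f : α → α)}
  one_mem' := IsQuasiIsometry.id
  mul_mem' := fun {f g} hf hg => IsQuasiIsometry.comp (g := f) (f := g) hf hg

/-- Being at bounded distance, as a congruence on the monoid of quasi-isometries. -/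
def QIMaps.con (α : Type u) [PseudoEMetricSpace α] : Con (QIMaps α) where
  r f g := AtBoundedDistance (f.1 : α → α) (g.1 : α → α)
  iseqv := ⟨fun f => AtBoundedDistance.equivalence.refl f.1,
    fun h => AtBoundedDistance.equivalence.symm h,
    fun h h' => AtBoundedDistance.equivalence.trans h h'⟩
  mul' := by
    rintro f f' g g' ⟨D, hD⟩ ⟨D', hD'⟩
    obtain ⟨K, C, -, -, -, h2, -⟩ := f.2
    refine ⟨K * D' + C + D, fun x => ?_⟩
    change edist (f.1 (g.1 x)) (f'.1 (g'.1 x)) ≤ _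
    refine (edist_triangle _ (f.1 (g'.1 x)) _).trans ?_
    push_cast
    refine add_le_add ((h2 _ _).trans ?_) (hD _)
    gcongr
    exact hD' x

/-- The quasi-isometry group: quasi-isometries modulo bounded distance, under composition. -/
def QI (α : Type u) [PseudoEMetricSpace α] : Type u := (QIMaps.con α).Quotient

/-- The class of a quasi-isometry. -/
def QI.mk {α : Type u} [PseudoEMetricSpace α] (f : QIMaps α) : QI α :=
  ((f : QIMaps α) : (QIMaps.con α).Quotient)

instance (α : Type u) [PseudoEMetricSpace α] : Monoid (QI α) :=
  inferInstanceAs (Monoid (QIMaps.con α).Quotient)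

theorem QI.exists_inv {α : Type u} [PseudoEMetricSpace α] (a : QI α) : ∃ b : QI α, b * a = 1 := by
  induction a using Con.induction_on with
  | H f =>
    obtain ⟨g, hg, h, -⟩ := IsQuasiIsometry.exists_inverse f.2
    exact ⟨QI.mk ⟨g, hg⟩, (Con.eq _).2 h⟩

instance (α : Type u) [PseudoEMetricSpace α] : Group (QI α) where
  inv a := Classical.choose (QI.exists_inv a)
  inv_mul_cancel a := Classical.choose_spec (QI.exists_inv a)

/-! ### Pointed homotopy equivalences -/

/-- Pointed continuous self-maps. -/
def PointedMap (Y : Type u) [TopologicalSpace Y] (y₀ : Y) : Type u := {f : C(Y, Y) // f y₀ = y₀}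

instance (Y : Type u) [TopologicalSpace Y] (y₀ : Y) : Monoid (PointedMap Y y₀) where
  mul f g := ⟨f.1.comp g.1, by rw [ContinuousMap.comp_apply, g.2, f.2]⟩
  one := ⟨ContinuousMap.id Y, rfl⟩
  mul_assoc _ _ _ := rfl
  one_mul _ := rfl
  mul_one _ := rfl

/-- Pointed homotopy: a homotopy that fixes the base point. -/
def PointedMap.Homotopic {Y : Type u} [TopologicalSpace Y] {y₀ : Y} (f g : PointedMap Y y₀) : Prop :=
  ContinuousMap.HomotopicRel f.1 g.1 {y₀}

theorem PointedMap.Homotopic.mul {Y : Type u} [TopologicalSpace Y] {y₀ : Y}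
    {f f' g g' : PointedMap Y y₀} (hf : f.Homotopic f') (hg : g.Homotopic g') :
    (f * g).Homotopic (f' * g') := by
  have h1 : (f * g).Homotopic (f * g') := hg.map fun F => F.compContinuousMap f.1
  have h2 : (f * g').Homotopic (f' * g') := by
    obtain ⟨F⟩ := hf
    refine ⟨⟨F.toHomotopy.comp (ContinuousMap.Homotopy.refl g'.1), ?_⟩⟩
    rintro t x rfl
    change F (t, g'.1 x) = f.1 (g'.1 x)
    rw [g'.2]
    exact F.prop t x rfl
  exact ContinuousMap.HomotopicRel.trans h1 h2

/-- The monoid of pointed homotopy equivalences of `(Y, y₀)` to itself. -/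
def HE (Y : Type u) [TopologicalSpace Y] (y₀ : Y) : Submonoid (PointedMap Y y₀) where
  carrier := {f | ∃ g : PointedMap Y y₀, (g * f).Homotopic 1 ∧ (f * g).Homotopic 1}
  one_mem' := ⟨1, ContinuousMap.HomotopicRel.refl _, ContinuousMap.HomotopicRel.refl _⟩
  mul_mem' := by
    rintro f f' ⟨g, h1, h2⟩ ⟨g', h1', h2'⟩
    refine ⟨g' * g, ?_, ?_⟩
    · have : (g' * (g * f) * f').Homotopic (g' * 1 * f') :=
        PointedMap.Homotopic.mul
          (PointedMap.Homotopic.mul (ContinuousMap.HomotopicRel.refl _ : g'.Homotopic g') h1)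
          (ContinuousMap.HomotopicRel.refl _ : f'.Homotopic f')
      rw [mul_one] at this
      exact ContinuousMap.HomotopicRel.trans this h1'
    · have : (f * (f' * g') * g).Homotopic (f * 1 * g) :=
        PointedMap.Homotopic.mul
          (PointedMap.Homotopic.mul (ContinuousMap.HomotopicRel.refl _ : f.Homotopic f) h2')
          (ContinuousMap.HomotopicRel.refl _ : g.Homotopic g)
      rw [mul_one] at this
      exact ContinuousMap.HomotopicRel.trans this h2

/-- Pointed homotopy, as a congruence on the monoid of pointed homotopy equivalences. -/
def HE.con (Y : Type u) [TopologicalSpace Y] (y₀ : Y) : Con (HE Y y₀) where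
  r f g := f.1.Homotopic g.1
  iseqv := ⟨fun f => ContinuousMap.HomotopicRel.refl f.1.1,
    fun h => ContinuousMap.HomotopicRel.symm h,
    fun h h' => ContinuousMap.HomotopicRel.trans h h'⟩
  mul' := fun h h' => PointedMap.Homotopic.mul h h'

/-- The group of pointed homotopy classes of pointed homotopy equivalences of `(Y, y₀)`. -/
def HoMod (Y : Type u) [TopologicalSpace Y] (y₀ : Y) : Type u := (HE.con Y y₀).Quotient

/-- The class of a pointed homotopy equivalence. -/
def HoMod.mk {Y : Type u} [TopologicalSpace Y] {y₀ : Y} (f : HE Y y₀) : HoMod Y y₀ :=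
  ((f : HE Y y₀) : (HE.con Y y₀).Quotient)

instance (Y : Type u) [TopologicalSpace Y] (y₀ : Y) : Monoid (HoMod Y y₀) :=
  inferInstanceAs (Monoid (HE.con Y y₀).Quotient)

theorem HoMod.exists_inv {Y : Type u} [TopologicalSpace Y] {y₀ : Y} (a : HoMod Y y₀) :
    ∃ b : HoMod Y y₀, b * a = 1 := by
  induction a using Con.induction_on with
  | H f =>
    obtain ⟨g, h1, h2⟩ := f.2
    exact ⟨HoMod.mk ⟨g, f.1, h2, h1⟩, (Con.eq _).2 h1⟩

instance (Y : Type u) [TopologicalSpace Y] (y₀ : Y) : Group (HoMod Y y₀) where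
  inv a := Classical.choose (HoMod.exists_inv a)
  inv_mul_cancel a := Classical.choose_spec (HoMod.exists_inv a)

end

/-! Write Ĝ for the inverse limit of the sets `H \ G`, a compact space in which every `g` has an
image. The map Ĝ × X̃ → S(X), `(a, x) ↦ a • x`, is continuous and sends `(g, x)` to the baseleaf
point of `g • x`. Residual finiteness and freeness of the deck action make `baseleafMap` injective,
and a path in the solenoid that starts on the baseleaf lifts to X̃. Hence a pointed map `f` has
exactly one restriction `r`.

The metric content is a uniformity over Ĝ. A continuous `c : I × Ĝ → S(X)`, projected to `X`, is a
path in the sup-metric space `C(Ĝ, X)`. One subdivision of `I` therefore makes all pieces short for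
every `g` at once, and short paths of `X` lift without monodromy. So the lifts of the paths `c (·,
g)` have displacements bounded independently of `g` (`exists_displacement_bound`). Taking `c (t, a)
= f (a • γ t)` bounds the distance of `r (g • x)` from `r (g • y)`; taking a homotopy bounds the
distance of two restrictions along an orbit.

By the Švarc–Milnor argument (`exists_wordLength_bound`) `G` is finitely generated and the orbit map
is a quasi-isometry. Finitely many orbit bounds, one for each generator, then make `r` Lipschitz on
the orbit for the word metric, and compactness of `X` extends this to a coarse Lipschitz bound on X̃
(`exists_coarse_lipschitz`). The restriction of a homotopy inverse is a coarse inverse, so `r` is a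
quasi-isometry, and its class depends only on that of `f`. Conjugation by the orbit map gives `Φ`.
-/

noncomputable section

/-! ### Lifting along covering maps -/

namespace IsCoveringMap

variable {E : Type*} {X : Type*} [TopologicalSpace E] [TopologicalSpace X] {p : E → X}

/-- Path lifting for covering maps, stated with bundled paths. -/
theorem exists_path_lift (cov : IsCoveringMap p) {e : E} {a b : X} (he : p e = a)
    (γ : Path a b) : ∃ (e' : E) (Γ : Path e e'), p e' = b ∧ ∀ t, p (Γ t) = γ t := by
  have h0 : γ.toContinuousMap 0 = p e := by rw [he]; exact γ.source
  have h1 : ∀ t, p (cov.liftPath γ.toContinuousMap e h0 t) = γ t :=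
    fun t => congrFun (cov.liftPath_lifts γ.toContinuousMap e h0) t
  refine ⟨cov.liftPath γ.toContinuousMap e h0 1,
    ⟨cov.liftPath γ.toContinuousMap e h0, cov.liftPath_zero .., rfl⟩, ?_, h1⟩
  rw [h1, γ.target]

theorem path_eq_of_comp_eq (cov : IsCoveringMap p) {Γ Γ' : I → E} (h : Continuous Γ)
    (h' : Continuous Γ') (hp : ∀ t, p (Γ t) = p (Γ' t)) (h0 : Γ 0 = Γ' 0) : Γ = Γ' :=
  cov.eq_of_comp_eq h h' (funext hp) 0 h0

/-- The local homeomorphisms given by `p` are charts of `E` modelled on `X`, and local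
path-connectedness passes to charted spaces. -/
theorem locallyPathConnectedSpace [LocallyPathConnectedSpace X] (cov : IsCoveringMap p) :
    LocallyPathConnectedSpace E := by
  choose e he hpe using cov.isLocalHomeomorph
  let _ : ChartedSpace X E :=
    { atlas := Set.range e
      chartAt := e
      mem_chart_source := he
      chart_mem_atlas := fun x => ⟨x, rfl⟩ }
  exact ChartedSpace.locallyPathConnectedSpace X E

end IsCoveringMap

/-! ### The deck action: freeness, transitivity on fibres, continuity -/

namespace UniversalCover

variable {X : Type u} [TopologicalSpace X] {x₀ : X} (U : UniversalCover.{u, v} X x₀)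

theorem continuous_proj : Continuous U.proj := U.isCoveringMap.continuous

theorem smul_def (g : FundamentalGroup X x₀) (x : U.Space) :
    g • x = (U.isCoveringMap.monodromy
      (Path.Homotopic.Quotient.trans (FundamentalGroup.toPath g⁻¹) (U.pathTo x)) U.fibreBase).1 :=
  rfl

@[simp] theorem proj_smul (g : FundamentalGroup X x₀) (x : U.Space) :
    U.proj (g • x) = U.proj x :=
  (U.isCoveringMap.monodromy
    (Path.Homotopic.Quotient.trans (FundamentalGroup.toPath g⁻¹) (U.pathTo x)) U.fibreBase).2

/-- A fixed point gives `g⁻¹ · pathTo x = pathTo x` by uniqueness of `pathTo`, and `pathTo x`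
cancels in the fundamental groupoid. -/
theorem eq_one_of_smul_eq {g : FundamentalGroup X x₀} {x : U.Space} (h : g • x = x) : g = 1 := by
  have h1 := U.pathTo_eq x _ (Subtype.ext h)
  have h2 : Path.Homotopic.Quotient.trans (FundamentalGroup.toPath g⁻¹)
      (Path.Homotopic.Quotient.trans (U.pathTo x) (U.pathTo x).symm) =
      Path.Homotopic.Quotient.trans (U.pathTo x) (U.pathTo x).symm := by
    rw [← Path.Homotopic.Quotient.trans_assoc, ← h1]
  rw [Path.Homotopic.Quotient.trans_symm, Path.Homotopic.Quotient.trans_refl] at h2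
  have h3 : g⁻¹ = 1 := h2
  exact inv_eq_one.1 h3

theorem exists_smul_eq {x y : U.Space} (h : U.proj x = U.proj y) :
    ∃ g : FundamentalGroup X x₀, g • x = y := by
  -- The loop goes out along the image of a path to `y` and back along that of a path to `x`. It
  -- represents `g⁻¹`, since the action is defined through inverses.
  refine ⟨(FundamentalGroup.fromPath (Path.Homotopic.Quotient.trans ((U.pathTo y).cast rfl h)
    (U.pathTo x).symm))⁻¹, ?_⟩
  rw [smul_def, inv_inv]
  have h2 : Path.Homotopic.Quotient.trans
      (Path.Homotopic.Quotient.trans ((U.pathTo y).cast rfl h) (U.pathTo x).symm) (U.pathTo x) =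
      (U.pathTo y).cast rfl h := by
    rw [Path.Homotopic.Quotient.trans_assoc, Path.Homotopic.Quotient.symm_trans,
      Path.Homotopic.Quotient.trans_refl]
  have h3 := U.monodromy_pathTo y
  have aux : ∀ (z : X) (hz : z = U.proj y),
      (U.isCoveringMap.monodromy ((U.pathTo y).cast rfl hz) U.fibreBase).1 = y := by
    rintro z rfl
    exact congrArg Subtype.val h3
  refine Eq.trans ?_ (aux _ h)
  exact congrArg (fun γ => (U.isCoveringMap.monodromy γ U.fibreBase).1) h2

theorem monodromy_inv_fibreBase (g : FundamentalGroup X x₀) :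
    (U.isCoveringMap.monodromy (FundamentalGroup.toPath g⁻¹) U.fibreBase).1 = g • U.base := by
  have aux : ∀ (z : X) (hz : z = x₀) (e : U.proj ⁻¹' {x₀}),
      (U.isCoveringMap.monodromy ((Path.Homotopic.Quotient.refl x₀).cast rfl hz) e).1 = e.1 := by
    rintro z rfl e
    exact congrArg Subtype.val (congrFun U.isCoveringMap.monodromy_refl e)
  have h := U.pathTo_eq U.base _ (Subtype.ext (aux _ U.proj_base U.fibreBase))
  rw [smul_def, U.isCoveringMap.monodromy_trans_apply, h]
  exact (aux _ U.proj_base _).symm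

theorem pathTo_eq_mk {x : U.Space} (δ : Path U.base x) :
    U.pathTo x = (Path.Homotopic.Quotient.mk (δ.map U.continuous_proj)).cast
      U.proj_base.symm rfl := by
  have h : Path.Homotopic.Quotient.mk (PathConnectedSpace.somePath U.base x) =
    Path.Homotopic.Quotient.mk δ := Subsingleton.elim _ _
  unfold pathTo
  rw [h]
  rfl

/-- The action carries a lift of a path starting at the base point to a lift of the same path. -/
theorem smul_eq_of_path (g : FundamentalGroup X x₀) {x y : U.Space} (δ : Path U.base x)
    (Γ : Path (g • U.base) y) (h : ∀ t, U.proj (Γ t) = U.proj (δ t)) : g • x = y := by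
  have hy : U.proj y = U.proj x := by simpa using h 1
  have hb : U.proj (g • U.base) = x₀ := (U.proj_smul g U.base).trans U.proj_base
  have h1 : U.isCoveringMap.monodromy (FundamentalGroup.toPath g⁻¹) U.fibreBase =
    ⟨g • U.base, hb⟩ := Subtype.ext (U.monodromy_inv_fibreBase g)
  rw [smul_def, U.isCoveringMap.monodromy_trans_apply, h1]
  have h2 : U.isCoveringMap.monodromy (U.pathTo x) ⟨g • U.base, hb⟩ = ⟨y, hy⟩ := by
    apply U.isCoveringMap.monodromy_eq_of_map_eq (ex := ⟨g • U.base, hb⟩) (ey := ⟨y, hy⟩)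
      (Path.Homotopic.Quotient.mk Γ)
    rw [U.pathTo_eq_mk δ]
    refine congrArg Path.Homotopic.Quotient.mk ?_
    ext t
    exact h t
  rw [h2]

/-- The projection of X̃ lifts through itself to a continuous `τ` taking the base point to its
translate by `g`. The images under `τ` of paths from the base point are lifts of the same paths, so
`τ` is the action of `g`. -/
theorem continuous_smul [LocallyPathConnectedSpace X] (g : FundamentalGroup X x₀) :
    Continuous fun x : U.Space => g • x := by
  have := U.isCoveringMap.locallyPathConnectedSpace
  obtain ⟨τ, ⟨h1, h2⟩, -⟩ := U.isCoveringMap.existsUnique_continuousMap_lifts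
    ⟨U.proj, U.continuous_proj⟩ (a₀ := U.base) (e₀ := g • U.base) (U.proj_smul g U.base)
  have h3 : (fun x : U.Space => g • x) = τ := by
    funext x
    exact U.smul_eq_of_path g (PathConnectedSpace.somePath U.base x)
      (((PathConnectedSpace.somePath U.base x).map τ.continuous).cast h1.symm rfl)
      fun t => congrFun h2 _
  rw [h3]
  exact τ.continuous

end UniversalCover

namespace UniversalCover

variable {X : Type u} [TopologicalSpace X] {x₀ : X} (U : UniversalCover.{u, v} X x₀)

/-! ### The baseleaf of the solenoid -/

theorem toCover_eq_iff {H : Subgroup (FundamentalGroup X x₀)} {x y : U.Space} :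
    U.toCover H x = U.toCover H y ↔ ∃ h ∈ H, h • y = x := by
  refine Quotient.eq''.trans ⟨?_, ?_⟩
  · rintro ⟨h, rfl⟩
    exact ⟨h.1, h.2, rfl⟩
  · rintro ⟨h, hh, rfl⟩
    exact ⟨⟨h, hh⟩, rfl⟩

theorem continuous_toCover (H : Subgroup (FundamentalGroup X x₀)) : Continuous (U.toCover H) :=
  continuous_quot_mk

theorem isCoveringMap_toCover [LocallyPathConnectedSpace X]
    (H : Subgroup (FundamentalGroup X x₀)) : IsCoveringMap (U.toCover H) := by
  have h : IsQuotientCoveringMap (U.toCover H) H :=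
    { isQuotientMap_quotient_mk' with
      continuous_const_smul := fun g => U.continuous_smul g.1
      apply_eq_iff_mem_orbit := Quotient.eq''
      disjoint := fun x => by
        -- On an open set where `proj` is injective, `g • y` and `y` can both lie only if they are
        -- equal, and then freeness gives `g = 1`.
        obtain ⟨V, hV, hx, hinj⟩ := U.isCoveringMap.isLocalHomeomorph.isLocallyInjective x
        refine ⟨V, hV.mem_nhds hx, ?_⟩
        rintro g ⟨_, ⟨y, hy, rfl⟩, hy'⟩
        exact Subtype.ext (U.eq_one_of_smul_eq (hinj hy' hy (U.proj_smul g.1 y))) }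
  exact h.isCoveringMap

/-- The covering map `X_H → X`. -/
def coverProj (H : Subgroup (FundamentalGroup X x₀)) : U.IntermediateCover H → X :=
  Quotient.lift U.proj (by
    rintro a b ⟨h, rfl⟩
    exact U.proj_smul h.1 b)

theorem continuous_coverProj (H : Subgroup (FundamentalGroup X x₀)) :
    Continuous (U.coverProj H) :=
  U.continuous_proj.quotient_lift _

theorem coverProj_bonding {H K : Subgroup (FundamentalGroup X x₀)} (h : H ≤ K)
    (z : U.IntermediateCover H) : U.coverProj K (U.bonding h z) = U.coverProj H z := by
  induction z using Quotient.inductionOn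
  rfl

/-- The projection of the solenoid to `X`. -/
def solenoidProj (z : U.Solenoid) : X := U.coverProj ⊤ (z.1 ⟨⊤, inferInstance⟩)

theorem continuous_solenoidProj : Continuous U.solenoidProj :=
  (U.continuous_coverProj ⊤).comp ((continuous_apply _).comp continuous_subtype_val)

theorem coverProj_eq_solenoidProj (z : U.Solenoid)
    (H : {H : Subgroup (FundamentalGroup X x₀) // H.FiniteIndex}) :
    U.coverProj H.1 (z.1 H) = U.solenoidProj z := by
  rw [solenoidProj, ← z.2 H ⟨⊤, inferInstance⟩ le_top, coverProj_bonding]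

@[simp] theorem solenoidProj_baseleafMap (x : U.Space) :
    U.solenoidProj (U.baseleafMap x) = U.proj x := rfl

theorem continuous_baseleafMap : Continuous U.baseleafMap :=
  Continuous.subtype_mk (continuous_pi fun H => U.continuous_toCover H.1) _

/-- Two points with the same image differ by some `g`. By freeness it is the only such element, so
it lies in every subgroup of finite index and is trivial. -/
theorem baseleafMap_injective (hG : Group.ResiduallyFinite (FundamentalGroup X x₀)) :
    Function.Injective U.baseleafMap := by
  intro x y hxy
  have h : ∀ H : Subgroup (FundamentalGroup X x₀), H.FiniteIndex → ∃ h ∈ H, h • y = x :=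
    fun H hH => U.toCover_eq_iff.1 (congrFun (congrArg Subtype.val hxy) ⟨H, hH⟩)
  obtain ⟨g, -, rfl⟩ := h ⊤ inferInstance
  have hg : g = 1 := Group.residuallyFinite_iff_forall_finiteIndex.1 hG g fun H hH => by
    obtain ⟨k, hk, hky⟩ := h H hH
    have : (g⁻¹ * k) • y = y := by rw [mul_smul, hky, inv_smul_smul]
    have := U.eq_one_of_smul_eq this
    rwa [← inv_mul_eq_one.1 this] at hk
  rw [hg, one_smul]

/-- A path in the solenoid that starts on the baseleaf lifts to the universal cover. -/
theorem exists_baseleaf_lift [LocallyPathConnectedSpace X] {c : I → U.Solenoid}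
    (hc : Continuous c) {y : U.Space} (h0 : U.baseleafMap y = c 0) :
    ∃ (y' : U.Space) (Γ : Path y y'), ∀ t, U.baseleafMap (Γ t) = c t := by
  obtain ⟨y', Γ, -, hΓ⟩ := U.isCoveringMap.exists_path_lift (e := y)
    (a := U.solenoidProj (c 0)) (by rw [← h0, solenoidProj_baseleafMap])
    ⟨⟨fun t => U.solenoidProj (c t), U.continuous_solenoidProj.comp hc⟩, rfl, rfl⟩
  refine ⟨y', Γ, fun t => Subtype.ext (funext fun H => ?_)⟩
  -- `Γ` was lifted from `X` alone. The lift `Δ` of the coordinate at `H` starts at the same point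
  -- and lies over the same path of `X`, so it equals `Γ`; thus `Γ` has the right coordinate at
  -- every `H`.
  obtain ⟨z, Δ, -, hΔ⟩ := (U.isCoveringMap_toCover H.1).exists_path_lift (e := y)
    (a := (c 0).1 H) (by rw [← h0]; rfl)
    ⟨⟨fun t => (c t).1 H, (continuous_apply H).comp (continuous_subtype_val.comp hc)⟩, rfl, rfl⟩
  have hΓΔ : (Γ : I → U.Space) = Δ := by
    refine U.isCoveringMap.path_eq_of_comp_eq Γ.continuous Δ.continuous (fun t => ?_) ?_
    · calc U.proj (Γ t) = U.solenoidProj (c t) := hΓ t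
        _ = U.coverProj H.1 ((c t).1 H) := (U.coverProj_eq_solenoidProj (c t) H).symm
        _ = U.coverProj H.1 (U.toCover H.1 (Δ t)) := congrArg _ (hΔ t).symm
        _ = U.proj (Δ t) := rfl
    · rw [Γ.source, Δ.source]
  rw [hΓΔ]
  exact hΔ t

/-- The image under `f` of a path from the base point to `x` starts on the baseleaf because `f` is
pointed, so it lifts; the end of the lift serves as `r x`. -/
theorem exists_baseleafRestriction [LocallyPathConnectedSpace X]
    (f : PointedMap U.Solenoid U.solenoidBase) :
    ∃ r : U.Space → U.Space, U.IsBaseleafRestriction f.1 r := by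
  have h : ∀ x, ∃ y, U.baseleafMap y = f.1 (U.baseleafMap x) := fun x => by
    obtain ⟨y, Γ, hΓ⟩ := U.exists_baseleaf_lift
      (c := fun t => f.1 (U.baseleafMap (PathConnectedSpace.somePath U.base x t)))
      (f.1.continuous.comp (U.continuous_baseleafMap.comp (Path.continuous _)))
      (y := U.base) (by rw [Path.source]; exact f.2.symm)
    exact ⟨y, by simpa using hΓ 1⟩
  choose r hr using h
  exact ⟨r, hr⟩

theorem exists_baseleaf_path [LocallyPathConnectedSpace X]
    (hG : Group.ResiduallyFinite (FundamentalGroup X x₀)) {c : I → U.Solenoid}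
    (hc : Continuous c) {y y' : U.Space} (h0 : U.baseleafMap y = c 0)
    (h1 : U.baseleafMap y' = c 1) :
    ∃ Γ : Path y y', ∀ t, U.baseleafMap (Γ t) = c t := by
  obtain ⟨z, Γ, hΓ⟩ := U.exists_baseleaf_lift hc h0
  obtain rfl : z = y' := U.baseleafMap_injective hG (by rw [h1, ← hΓ 1, Γ.target])
  exact ⟨Γ, hΓ⟩

variable {U} in
theorem IsBaseleafRestriction.comp {f f' : U.Solenoid → U.Solenoid} {r r' : U.Space → U.Space}
    (hr : U.IsBaseleafRestriction f r) (hr' : U.IsBaseleafRestriction f' r') :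
    U.IsBaseleafRestriction (fun z => f (f' z)) (fun x => r (r' x)) :=
  fun x => (hr (r' x)).trans (congrArg f (hr' x))

variable {U} in
theorem IsBaseleafRestriction.eq (hG : Group.ResiduallyFinite (FundamentalGroup X x₀))
    {f : U.Solenoid → U.Solenoid} {r r' : U.Space → U.Space}
    (hr : U.IsBaseleafRestriction f r) (hr' : U.IsBaseleafRestriction f r') : r = r' :=
  funext fun x => U.baseleafMap_injective hG ((hr x).trans (hr' x).symm)

/-! ### Compactness of the space of coherent cosets -/

/-- The set `H \ G` with the discrete topology. -/
def RightCosets (H : Subgroup (FundamentalGroup X x₀)) : Type u :=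
  Quotient (QuotientGroup.rightRel H)

instance (H : Subgroup (FundamentalGroup X x₀)) : TopologicalSpace (RightCosets H) := ⊥

instance (H : Subgroup (FundamentalGroup X x₀)) : DiscreteTopology (RightCosets H) := ⟨rfl⟩

theorem finite_rightCosets {H : Subgroup (FundamentalGroup X x₀)} (hH : H.FiniteIndex) :
    Finite (RightCosets H) :=
  Finite.of_equiv _ (QuotientGroup.quotientRightRelEquivQuotientLeftRel H).symm

/-- The map `H \ G → K \ G` for `H ≤ K`. -/
def rightCosetsMap {H K : Subgroup (FundamentalGroup X x₀)} (h : H ≤ K) :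
    RightCosets H → RightCosets K :=
  Quotient.map id (by
    rintro a b ⟨k, hk⟩
    exact ⟨⟨k.1, h k.2⟩, hk⟩)

variable (X x₀) in
/-- The inverse limit of the sets `H \ G` over all subgroups `H` of finite index. -/
def CoherentCosets : Type u :=
  {a : (H : {H : Subgroup (FundamentalGroup X x₀) // H.FiniteIndex}) → RightCosets H.1 //
    ∀ (H K : {H : Subgroup (FundamentalGroup X x₀) // H.FiniteIndex}) (h : H.1 ≤ K.1),
      rightCosetsMap h (a H) = a K}

instance : TopologicalSpace (CoherentCosets X x₀) := instTopologicalSpaceSubtype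

/-- Coherence is a closed condition in a product of finite discrete spaces. Compactness provides the
sup metric on `C(CoherentCosets X x₀, X)`, the source of all uniformity in `g`. -/
instance : CompactSpace (CoherentCosets X x₀) := by
  have : ∀ H : {H : Subgroup (FundamentalGroup X x₀) // H.FiniteIndex},
      CompactSpace (RightCosets H.1) := fun H => by
    have := finite_rightCosets H.2
    infer_instance
  have hclosed : IsClosed {a : (H : {H : Subgroup (FundamentalGroup X x₀) // H.FiniteIndex}) →
      RightCosets H.1 | ∀ (H K : {H : Subgroup (FundamentalGroup X x₀) // H.FiniteIndex})
        (h : H.1 ≤ K.1), rightCosetsMap h (a H) = a K} := by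
    simp only [Set.ofPred_forall]
    refine isClosed_iInter fun H => isClosed_iInter fun K => isClosed_iInter fun h => ?_
    exact isClosed_eq (continuous_of_discreteTopology.comp (continuous_apply H))
      (continuous_apply K)
  exact isCompact_iff_compactSpace.1 hclosed.isCompact

/-- The coherent family of the cosets of `g`. -/
def cosetsOf (g : FundamentalGroup X x₀) : CoherentCosets X x₀ :=
  ⟨fun H => Quotient.mk (QuotientGroup.rightRel H.1) g, fun _ _ _ => rfl⟩

/-- The map `H \ G × X̃ → H \ X̃`. -/
def cosetSMul (H : Subgroup (FundamentalGroup X x₀)) (a : RightCosets H) (x : U.Space) :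
    U.IntermediateCover H :=
  Quotient.lift (fun g : FundamentalGroup X x₀ => U.toCover H (g • x)) (by
    rintro a b ⟨h, rfl⟩
    exact U.toCover_eq_iff.2 ⟨h.1, h.2, (mul_smul h.1 b x).symm⟩) a

theorem continuous_cosetSMul [LocallyPathConnectedSpace X]
    (H : Subgroup (FundamentalGroup X x₀)) :
    Continuous fun q : RightCosets H × U.Space => U.cosetSMul H q.1 q.2 := by
  refine continuous_prod_of_discrete_left.2 fun a => ?_
  induction a using Quotient.inductionOn with
  | h g => exact (U.continuous_toCover H).comp (U.continuous_smul g)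

/-- The solenoid as a quotient of the product of the profinite completion and the universal
cover. -/
def solenoidSMul (a : CoherentCosets X x₀) (x : U.Space) : U.Solenoid :=
  ⟨fun H => U.cosetSMul H.1 (a.1 H) x, fun H K h => by
    have aux : ∀ b : RightCosets H.1, U.bonding h (U.cosetSMul H.1 b x) =
        U.cosetSMul K.1 (rightCosetsMap h b) x := fun b => by
      induction b using Quotient.inductionOn
      rfl
    exact (aux (a.1 H)).trans (congrArg (fun b => U.cosetSMul K.1 b x) (a.2 H K h))⟩

@[simp] theorem solenoidSMul_cosetsOf (g : FundamentalGroup X x₀) (x : U.Space) :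
    U.solenoidSMul (cosetsOf g) x = U.baseleafMap (g • x) := rfl

theorem continuous_solenoidSMul [LocallyPathConnectedSpace X] :
    Continuous fun q : CoherentCosets X x₀ × U.Space => U.solenoidSMul q.1 q.2 :=
  Continuous.subtype_mk (continuous_pi fun H => show Continuous
      ((fun q : RightCosets H.1 × U.Space => U.cosetSMul H.1 q.1 q.2) ∘
        fun q : CoherentCosets X x₀ × U.Space => (q.1.1 H, q.2)) from
    (U.continuous_cosetSMul H.1).comp
      (((continuous_apply H).comp (continuous_subtype_val.comp continuous_fst)).prodMk
        continuous_snd)) _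

end UniversalCover

/-! ### Geodesics and short paths in the universal cover -/

/-- A geodesic rescaled to `I` is Lipschitz with constant `dist a b`. The second bound keeps it in a
ball, where lifting has no monodromy. -/
theorem IsGeodesicMetricSpace.exists_path {X : Type u} [MetricSpace X]
    (hgeo : IsGeodesicMetricSpace X) (a b : X) :
    ∃ δ : Path a b, curveLength δ ≤ edist a b ∧ ∀ t, dist a (δ t) ≤ dist a b := by
  obtain ⟨γ, h0, h1, hγ⟩ := hgeo a b
  have hmem : ∀ t : I, dist a b * (t : ℝ) ∈ Set.Icc 0 (dist a b) := fun t =>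
    ⟨mul_nonneg dist_nonneg t.2.1, mul_le_of_le_one_right dist_nonneg t.2.2⟩
  have hd : ∀ s t : I, dist (γ (dist a b * s)) (γ (dist a b * t)) = dist a b * dist s t :=
    fun s t => by
      rw [hγ _ (hmem s) _ (hmem t), ← mul_sub, abs_mul, abs_of_nonneg dist_nonneg]
      rfl
  have hlip : LipschitzWith (nndist a b) fun t : I => γ (dist a b * t) :=
    LipschitzWith.of_dist_le_mul fun s t => (hd s t).le
  refine ⟨⟨⟨fun t => γ (dist a b * t), hlip.continuous⟩, by simp [h0], by simp [h1]⟩, ?_, ?_⟩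
  · have h2 := (hlip.lipschitzOnWith (s := Set.univ)).comp_eVariationOn_le
      (g := fun t : I => t) (s := Set.univ) (fun _ _ => Set.mem_univ _)
    have h3 : eVariationOn (fun t : I => t) Set.univ ≤ 1 := by
      have h4 : eVariationOn (fun t : I => (t : ℝ)) Set.univ ≤ 1 := by
        have h5 := (show MonotoneOn (fun t : I => (t : ℝ)) Set.univ from
          fun s _ t _ h => h).eVariationOn_eq (Set.mem_univ 0) (Set.mem_univ 1)
        have h6 : Set.univ ∩ Set.Icc (0 : I) 1 = Set.univ :=
          Set.eq_univ_of_forall fun t : I => ⟨Set.mem_univ t, Set.mem_Icc.2 ⟨t.2.1, t.2.2⟩⟩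
        rw [h6] at h5
        simp [h5]
      exact h4
    calc eVariationOn (fun t : I => γ (dist a b * t)) Set.univ
        ≤ (nndist a b : ℝ≥0∞) * eVariationOn (fun t : I => t) Set.univ := h2
      _ ≤ (nndist a b : ℝ≥0∞) * 1 := by gcongr
      _ = edist a b := by rw [mul_one, edist_nndist]
  · intro t
    have := hd 0 t
    simp only [Set.Icc.coe_zero, mul_zero, h0] at this
    calc dist a (γ (dist a b * t)) = dist a b * dist 0 t := this
      _ ≤ dist a b := mul_le_of_le_one_right dist_nonneg (by
        rw [dist_comm]
        simpa [Subtype.dist_eq, abs_of_nonneg t.2.1] using t.2.2)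

theorem curveLength_subpath_le {X : Type u} {E : Type v} [PseudoEMetricSpace X]
    [TopologicalSpace E] (p : E → X) {x y : E} (γ : Path x y) {s t : I} (h : s ≤ t) :
    curveLength (p ∘ γ.subpath s t) ≤ eVariationOn (p ∘ γ) (Set.Icc s t) := by
  refine eVariationOn.comp_le_of_monotoneOn (p ∘ γ) _
    (fun a _ b _ hab => ?_) (fun a _ => ?_)
  · have h1 : (s : ℝ) ≤ t := h
    have h2 : (a : ℝ) ≤ b := hab
    change (1 - (a : ℝ)) * s + a * t ≤ (1 - (b : ℝ)) * s + b * t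
    nlinarith
  · have := Path.range_subpathAux s t ▸ Set.mem_range_self a
    rwa [Set.uIcc_of_le h] at this

namespace UniversalCover

variable {X : Type u} [MetricSpace X] {x₀ : X} (U : UniversalCover.{u, v} X x₀)

/-- The length metric on the universal cover. -/
def lengthDist (x y : U.Space) : ℝ≥0∞ := edist (show U.Metrized from x) (show U.Metrized from y)

theorem lengthDist_self (x : U.Space) : U.lengthDist x x = 0 :=
  edist_self (show U.Metrized from x)

theorem lengthDist_comm (x y : U.Space) : U.lengthDist x y = U.lengthDist y x :=
  edist_comm (show U.Metrized from x) (show U.Metrized from y)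

theorem lengthDist_triangle (x y z : U.Space) :
    U.lengthDist x z ≤ U.lengthDist x y + U.lengthDist y z :=
  edist_triangle (show U.Metrized from x) (show U.Metrized from y) (show U.Metrized from z)

theorem lengthDist_le_curveLength {x y : U.Space} (γ : Path x y) :
    U.lengthDist x y ≤ curveLength (U.proj ∘ γ) :=
  iInf_le _ γ

theorem exists_path_of_lengthDist_lt {x y : U.Space} {L : ℝ≥0∞} (h : U.lengthDist x y < L) :
    ∃ γ : Path x y, curveLength (U.proj ∘ γ) < L :=
  iInf_lt_iff.1 h

theorem lengthDist_smul [LocallyPathConnectedSpace X] (g : FundamentalGroup X x₀)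
    (x y : U.Space) : U.lengthDist (g • x) (g • y) = U.lengthDist x y := by
  have key : ∀ (g : FundamentalGroup X x₀) (x y : U.Space),
      U.lengthDist (g • x) (g • y) ≤ U.lengthDist x y := fun g x y => by
    refine le_iInf fun γ : Path x y => ?_
    refine (U.lengthDist_le_curveLength (γ.map (U.continuous_smul g))).trans (le_of_eq ?_)
    congr 1
    funext t
    exact U.proj_smul g (γ t)
  refine le_antisymm (key g x y) ?_
  simpa using key g⁻¹ (g • x) (g • y)

theorem exists_geodesic_lift (hgeo : IsGeodesicMetricSpace X) (x : U.Space) (b : X) :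
    ∃ (y : U.Space) (Γ : Path x y), U.proj y = b ∧
      curveLength (U.proj ∘ Γ) ≤ edist (U.proj x) b ∧
      ∀ t, dist (U.proj x) (U.proj (Γ t)) ≤ dist (U.proj x) b := by
  obtain ⟨δ, h1, h2⟩ := hgeo.exists_path (U.proj x) b
  obtain ⟨y, Γ, hy, hΓ⟩ := U.isCoveringMap.exists_path_lift (e := x) rfl δ
  have h3 : U.proj ∘ Γ = δ := funext hΓ
  exact ⟨y, Γ, hy, h3 ▸ h1, fun t => by rw [hΓ]; exact h2 t⟩

theorem exists_proj_eq_lengthDist_le (hgeo : IsGeodesicMetricSpace X) (x : U.Space) (b : X) :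
    ∃ y : U.Space, U.proj y = b ∧ U.lengthDist x y ≤ edist (U.proj x) b := by
  obtain ⟨y, Γ, hy, h, -⟩ := U.exists_geodesic_lift hgeo x b
  exact ⟨y, hy, (U.lengthDist_le_curveLength Γ).trans h⟩

/-- Paths of the universal cover that lie over a ball of radius `ρ` are closed if their projections
are. -/
structure IsLiftRadius (ρ : ℝ) : Prop where
  pos : 0 < ρ
  eq_of_path : ∀ (c : X) {x y : U.Space} (γ : Path x y), (∀ t, dist c (U.proj (γ t)) < ρ) →
    U.proj x = U.proj y → x = y

/-- A Lebesgue number of a cover by evenly covered sets works: over such a set the sheet of a path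
is a continuous function from `I` to a discrete fibre, hence constant. -/
theorem exists_isLiftRadius [CompactSpace X] : ∃ ρ, U.IsLiftRadius ρ := by
  choose hdisc V hxV hV hV' H hH using U.isCoveringMap
  obtain ⟨ρ, hρ, h⟩ := lebesgue_number_lemma_of_metric (isCompact_univ (X := X)) hV
    (fun x _ => Set.mem_iUnion.2 ⟨x, hxV x⟩)
  refine ⟨ρ, hρ, fun c x y γ hγ hxy => ?_⟩
  obtain ⟨b, hb⟩ := h c (Set.mem_univ c)
  have hmem : ∀ t, γ t ∈ U.proj ⁻¹' V b := fun t => hb (by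
    rw [Metric.mem_ball, dist_comm]
    exact hγ t)
  let δ : I → U.proj ⁻¹' V b := fun t => ⟨γ t, hmem t⟩
  have hδ : Continuous δ := γ.continuous.subtype_mk _
  have h2 : (H b (δ 0)).2 = (H b (δ 1)).2 := by
    have := hdisc b
    exact PreconnectedSpace.constant inferInstance
      (continuous_snd.comp ((H b).continuous.comp hδ))
  have h1 : (H b (δ 0)).1 = (H b (δ 1)).1 := by
    refine Subtype.ext ?_
    rw [hH, hH]
    simpa [δ] using hxy
  have h3 := congrArg Subtype.val ((H b).injective (Prod.ext h1 h2))
  simpa [δ] using h3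

variable {U}

/-- The geodesic in `X` lifted from `x` ends at `y`: preceded by the reverse of `γ` it stays over
the ball and joins two points of one fibre. -/
theorem IsLiftRadius.lengthDist_le {ρ : ℝ} (hρ : U.IsLiftRadius ρ)
    (hgeo : IsGeodesicMetricSpace X) {x y : U.Space} (γ : Path x y)
    (h : ∀ t, dist (U.proj x) (U.proj (γ t)) < ρ) :
    U.lengthDist x y ≤ edist (U.proj x) (U.proj y) := by
  obtain ⟨z, Γ, hz, hlen, hΓ⟩ := U.exists_geodesic_lift hgeo x (U.proj y)
  have hy : dist (U.proj x) (U.proj y) < ρ := by simpa using h 1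
  obtain rfl : y = z := by
    refine hρ.eq_of_path (U.proj x) (γ.symm.trans Γ) (fun t => ?_) hz.symm
    have : γ.symm.trans Γ t ∈ Set.range γ ∪ Set.range Γ := by
      rw [← γ.symm_range, ← Path.trans_range]
      exact Set.mem_range_self t
    rcases this with ⟨s, hs⟩ | ⟨s, hs⟩
    · rw [← hs]; exact h s
    · rw [← hs]; exact (hΓ s).trans_lt hy
  exact (U.lengthDist_le_curveLength Γ).trans hlen

theorem edist_proj_le_curveLength {x y : U.Space} (γ : Path x y) (t : I) :
    edist (U.proj x) (U.proj (γ t)) ≤ curveLength (U.proj ∘ γ) := by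
  have := eVariationOn.edist_le (U.proj ∘ γ) (Set.mem_univ 0) (Set.mem_univ t)
  simp only [Function.comp, Path.source] at this
  exact this

/-- Fibres are `ρ`-separated, since a path of length less than `ρ` stays over a ball of radius `ρ`.
-/
theorem IsLiftRadius.eq_of_lengthDist_lt {ρ : ℝ} (hρ : U.IsLiftRadius ρ) {x y : U.Space}
    (h : U.lengthDist x y < ENNReal.ofReal ρ) (hxy : U.proj x = U.proj y) : x = y := by
  obtain ⟨γ, hγ⟩ := U.exists_path_of_lengthDist_lt h
  refine hρ.eq_of_path (U.proj x) γ (fun t => ?_) hxy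
  have := (edist_proj_le_curveLength γ t).trans_lt hγ
  rwa [edist_dist, ENNReal.ofReal_lt_ofReal_iff hρ.pos] at this

/-- Cut `γ` at the first time its projection is at distance `ε` from its start. The first piece lies
over a ball of radius less than `ρ`, so its ends are at distance at most `ε`, while its length is at
least `ε`; the remaining length bounds the distance left. This replaces a subdivision of `γ` by arc
length. -/
theorem IsLiftRadius.exists_step {ρ ε : ℝ} (hρ : U.IsLiftRadius ρ)
    (hgeo : IsGeodesicMetricSpace X) (hε : 0 < ε) (hερ : ε < ρ) {x y : U.Space} (γ : Path x y) :
    U.lengthDist x y ≤ ENNReal.ofReal ε ∨ ∃ z, U.lengthDist x z ≤ ENNReal.ofReal ε ∧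
      ENNReal.ofReal ε + U.lengthDist z y ≤ curveLength (U.proj ∘ γ) := by
  have hφ : Continuous fun t => dist (U.proj x) (U.proj (γ t)) :=
    continuous_const.dist (U.continuous_proj.comp γ.continuous)
  by_cases hall : ∀ t, dist (U.proj x) (U.proj (γ t)) < ε
  · left
    refine (hρ.lengthDist_le hgeo γ fun t => (hall t).trans hερ).trans ?_
    rw [edist_dist]
    exact ENNReal.ofReal_le_ofReal (by simpa using (hall 1).le)
  right
  push Not at hall
  obtain ⟨t₁, ht₁⟩ := hall
  have hivt : ∀ t, ε ≤ dist (U.proj x) (U.proj (γ t)) →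
      ∃ s ≤ t, dist (U.proj x) (U.proj (γ s)) = ε := fun t ht => by
    obtain ⟨s, hs, h⟩ := intermediate_value_Icc (show (0 : I) ≤ t from t.2.1) hφ.continuousOn
      (show ε ∈ Set.Icc _ _ from ⟨by simpa using hε.le, ht⟩)
    exact ⟨s, hs.2, h⟩
  obtain ⟨s₁, -, hs₁⟩ := hivt t₁ ht₁
  have hcpt : IsCompact {t : I | dist (U.proj x) (U.proj (γ t)) = ε} :=
    (isClosed_eq hφ continuous_const).isCompact
  obtain ⟨t₀, ht₀, hmin⟩ := hcpt.exists_isLeast ⟨s₁, hs₁⟩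
  have ht₀' : dist (U.proj x) (U.proj (γ t₀)) = ε := ht₀
  -- Exceeding `ε` before `t₀` would, by the intermediate value theorem, give an earlier time at
  -- distance exactly `ε`.
  have hlt : ∀ t ≤ t₀, dist (U.proj x) (U.proj (γ t)) ≤ ε := fun t ht => by
    by_contra! hcon
    obtain ⟨s, hst, hs⟩ := hivt t hcon.le
    have : t = t₀ := le_antisymm ht ((hmin hs).trans hst)
    rw [this, ht₀'] at hcon
    exact hcon.false
  refine ⟨γ t₀, ?_, ?_⟩
  · have hx : γ 0 = x := γ.source
    have := hρ.lengthDist_le hgeo ((γ.subpath 0 t₀).cast hx.symm rfl) (fun t => ?_)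
    · rwa [edist_dist, ht₀'] at this
    · refine lt_of_le_of_lt ?_ hερ
      have hm : γ.subpath 0 t₀ t ∈ γ '' Set.Icc 0 t₀ := by
        rw [← γ.range_subpath_of_le 0 t₀ t₀.2.1]
        exact Set.mem_range_self t
      obtain ⟨s, hs, hst⟩ := hm
      change dist _ (U.proj (γ.subpath 0 t₀ t)) ≤ ε
      rw [← hst]
      exact hlt s hs.2
  · have hsplit : curveLength (U.proj ∘ γ) = eVariationOn (U.proj ∘ γ) (Set.Icc 0 t₀) +
        eVariationOn (U.proj ∘ γ) (Set.Icc t₀ 1) := by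
      have := eVariationOn.Icc_add_Icc (U.proj ∘ γ) (s := Set.univ)
        (show (0 : I) ≤ t₀ from t₀.2.1) (show t₀ ≤ 1 from t₀.2.2) (Set.mem_univ _)
      simp only [Set.univ_inter] at this
      rw [this]
      unfold curveLength
      congr 1
      exact (Set.eq_univ_of_forall fun t : I => Set.mem_Icc.2 ⟨t.2.1, t.2.2⟩).symm
    rw [hsplit]
    refine add_le_add ?_ ?_
    · have := eVariationOn.edist_le (U.proj ∘ γ)
        (show (0 : I) ∈ Set.Icc 0 t₀ from ⟨le_rfl, t₀.2.1⟩)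
        (show t₀ ∈ Set.Icc 0 t₀ from ⟨t₀.2.1, le_rfl⟩)
      simp only [Function.comp, Path.source] at this
      rwa [edist_dist, ht₀'] at this
    · have hy : γ 1 = y := γ.target
      exact (U.lengthDist_le_curveLength ((γ.subpath t₀ 1).cast rfl hy.symm)).trans
        (curveLength_subpath_le U.proj γ t₀.2.2)

/-- Points at distance less than `n ε` are joined by a chain of `n` steps of size `ε`. -/
theorem IsLiftRadius.exists_chain {ρ ε : ℝ} (hρ : U.IsLiftRadius ρ)
    (hgeo : IsGeodesicMetricSpace X) (hε : 0 < ε) (hερ : ε < ρ) (n : ℕ) {x y : U.Space}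
    (h : U.lengthDist x y < n * ENNReal.ofReal ε) :
    ∃ z : ℕ → U.Space, z 0 = x ∧ z n = y ∧
      ∀ i < n, U.lengthDist (z i) (z (i + 1)) ≤ ENNReal.ofReal ε := by
  induction n generalizing x with
  | zero => simp at h
  | succ n ih =>
    obtain ⟨γ, hγ⟩ := U.exists_path_of_lengthDist_lt h
    rcases hρ.exists_step hgeo hε hερ γ with h1 | ⟨w, h1, h2⟩
    -- A single step suffices, and the rest of the chain stays at `y`.
    · refine ⟨fun i => if i = 0 then x else y, by simp, by simp, fun i _ => ?_⟩
      by_cases hi : i = 0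
      · simpa [hi] using h1
      · simp [hi, U.lengthDist_self]
    · have h3 : ENNReal.ofReal ε + U.lengthDist w y <
          ENNReal.ofReal ε + n * ENNReal.ofReal ε := by
        refine (h2.trans_lt hγ).trans_eq ?_
        push_cast
        ring
      obtain ⟨z, hz0, hzn, hz⟩ := ih ((ENNReal.add_lt_add_iff_left ENNReal.ofReal_ne_top).1 h3)
      refine ⟨fun i => Nat.casesOn i x z, rfl, hzn, fun i hi => ?_⟩
      cases i with
      | zero => simpa [hz0] using h1
      | succ i => exact hz i (by omega)

end UniversalCover

namespace UniversalCover

variable {X : Type u} [MetricSpace X] [LocallyPathConnectedSpace X] {x₀ : X}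
  {U : UniversalCover.{u, v} X x₀}

/-! ### Displacements of families of paths in the solenoid -/

/-- A path in the solenoid that depends continuously on an element of the profinite completion
moves the points of the baseleaf a bounded distance. -/
theorem IsLiftRadius.exists_displacement_bound {ρ : ℝ} (hρ : U.IsLiftRadius ρ)
    (hgeo : IsGeodesicMetricSpace X) (hG : Group.ResiduallyFinite (FundamentalGroup X x₀))
    {c : I × CoherentCosets X x₀ → U.Solenoid} (hc : Continuous c) :
    ∃ C : ℝ≥0, ∀ (g : FundamentalGroup X x₀) (y y' : U.Space),
      U.baseleafMap y = c (0, cosetsOf g) → U.baseleafMap y' = c (1, cosetsOf g) →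
      U.lengthDist y y' ≤ C := by
  -- Uniform continuity of the curried map, in the sup metric, gives a `δ` that serves all `g`
  -- together.
  let F : C(I, C(CoherentCosets X x₀, X)) :=
    ContinuousMap.curry ⟨fun q => U.solenoidProj (c q), U.continuous_solenoidProj.comp hc⟩
  obtain ⟨δ, hδ, hF⟩ := Metric.uniformContinuous_iff.1
    (CompactSpace.uniformContinuous_of_continuous F.continuous) ρ hρ.pos
  obtain ⟨n, hn⟩ := exists_nat_one_div_lt hδ
  refine ⟨(n + 1 : ℕ) * ρ.toNNReal, fun g y y' h0 h1 => ?_⟩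
  obtain ⟨Γ, hΓ⟩ := U.exists_baseleaf_path hG (c := fun t => c (t, cosetsOf g))
    (hc.comp (by fun_prop)) h0 h1
  have hproj : ∀ t, U.proj (Γ t) = F t (cosetsOf g) := fun t => by
    rw [← solenoidProj_baseleafMap, hΓ]
    rfl
  have hn0 : (0 : ℝ) < n + 1 := by positivity
  -- The `n + 1` equal pieces are shorter than `δ`, so each projects into a ball of radius `ρ` and
  -- contributes at most `ρ`.
  let τ : ℕ → I := fun i => Set.projIcc (0 : ℝ) 1 zero_le_one (i / (n + 1))
  have hτ : Monotone τ := fun i j hij => Set.monotone_projIcc _ (by gcongr)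
  have hstep : ∀ i, U.lengthDist (Γ (τ i)) (Γ (τ (i + 1))) ≤ ENNReal.ofReal ρ := fun i => by
    have hclose : ∀ s ∈ Set.Icc (τ i) (τ (i + 1)),
        dist (U.proj (Γ (τ i))) (U.proj (Γ s)) < ρ := fun s hs => by
      rw [hproj, hproj]
      refine (ContinuousMap.dist_apply_le_dist _).trans_lt (hF (lt_of_le_of_lt ?_ hn))
      have h2 : dist (τ i) (τ (i + 1)) ≤ 1 / (n + 1) := by
        have := (LipschitzWith.projIcc (zero_le_one' ℝ)).dist_le_mul (i / (n + 1) : ℝ)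
          ((i + 1 : ℕ) / (n + 1))
        refine this.trans (le_of_eq ?_)
        rw [NNReal.coe_one, one_mul, Real.dist_eq, abs_sub_comm, ← sub_div]
        push_cast
        rw [add_sub_cancel_left, abs_of_pos (by positivity)]
      refine le_trans ?_ h2
      have h3 : (τ i : ℝ) ≤ s := hs.1
      have h4 : (s : ℝ) ≤ τ (i + 1) := hs.2
      rw [Subtype.dist_eq, Subtype.dist_eq, Real.dist_eq, Real.dist_eq, abs_sub_comm,
        abs_sub_comm (τ i : ℝ), abs_of_nonneg (by linarith), abs_of_nonneg (by linarith)]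
      linarith
    have hle : τ i ≤ τ (i + 1) := hτ (Nat.le_succ i)
    refine (hρ.lengthDist_le hgeo (Γ.subpath (τ i) (τ (i + 1))) fun t => ?_).trans ?_
    · have hm : Γ.subpath (τ i) (τ (i + 1)) t ∈ Γ '' Set.Icc (τ i) (τ (i + 1)) := by
        rw [← Γ.range_subpath_of_le _ _ hle]
        exact Set.mem_range_self t
      obtain ⟨s, hs, hst⟩ := hm
      rw [← hst]
      exact hclose s hs
    · rw [edist_dist]
      exact ENNReal.ofReal_le_ofReal (hclose _ ⟨hle, le_rfl⟩).le
  have hsum : ∀ i : ℕ, U.lengthDist (Γ (τ 0)) (Γ (τ i)) ≤ i * ENNReal.ofReal ρ := fun i => by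
    induction i with
    | zero => simp [U.lengthDist_self]
    | succ i ih =>
      refine (U.lengthDist_triangle _ (Γ (τ i)) _).trans ((add_le_add ih (hstep i)).trans_eq ?_)
      push_cast
      ring
  have h := hsum (n + 1)
  have hτ0 : τ 0 = 0 := by
    simp [τ]
  have hτ1 : τ (n + 1) = 1 := by
    have : ((n + 1 : ℕ) : ℝ) / (n + 1) = 1 := by
      push_cast
      exact div_self hn0.ne'
    exact Set.projIcc_of_right_le _ this.ge
  rw [hτ0, hτ1, Γ.source, Γ.target] at h
  simpa [ENNReal.ofReal] using h

/-- The map sending `y` to `a ↦` the projection of `f (a • y)` is continuous into the sup metric,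
hence varies by less than `ρ` near `x`. A short geodesic from the projection of `x`, lifted by the
local inverse at `x`, stays in that neighbourhood; its translates by all `g` are then carried by `f`
to baseleaf paths over balls of radius `ρ`. -/
theorem IsBaseleafRestriction.exists_local_bound {ρ : ℝ} (hρ : U.IsLiftRadius ρ)
    (hgeo : IsGeodesicMetricSpace X)
    (hG : Group.ResiduallyFinite (FundamentalGroup X x₀)) {f : C(U.Solenoid, U.Solenoid)}
    {r : U.Space → U.Space} (hr : U.IsBaseleafRestriction f r) (x : U.Space) :
    ∃ δ > 0, ∀ b, dist (U.proj x) b < δ → ∃ y, U.proj y = b ∧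
      U.lengthDist x y ≤ edist (U.proj x) b ∧
      ∀ g : FundamentalGroup X x₀,
        U.lengthDist (r (g • x)) (r (g • y)) ≤ ENNReal.ofReal ρ := by
  let F : C(U.Space, C(CoherentCosets X x₀, X)) :=
    ContinuousMap.curry ⟨fun q : U.Space × CoherentCosets X x₀ =>
      U.solenoidProj (f (U.solenoidSMul q.2 q.1)),
      U.continuous_solenoidProj.comp (f.continuous.comp (U.continuous_solenoidSMul.comp
        (continuous_snd.prodMk continuous_fst)))⟩
  have hF : ∀ (g : FundamentalGroup X x₀) (y : U.Space),
      F y (cosetsOf g) = U.solenoidProj (f (U.baseleafMap (g • y))) := fun g y => rfl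
  obtain ⟨e, he, hpe⟩ := U.isCoveringMap.isLocalHomeomorph x
  have hpe' : ∀ z, e z = U.proj z := fun z => (congrFun hpe z).symm
  have hopen : IsOpen (e.target ∩ e.symm ⁻¹' {y | dist (F x) (F y) < ρ}) :=
    e.isOpen_inter_preimage_symm
      (isOpen_lt (continuous_const.dist F.continuous) continuous_const)
  have hsx : e.symm (U.proj x) = x := by rw [← hpe', e.left_inv he]
  have hx : U.proj x ∈ e.target ∩ e.symm ⁻¹' {y | dist (F x) (F y) < ρ} := by
    refine ⟨hpe' x ▸ e.map_source he, ?_⟩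
    change dist (F x) (F (e.symm (U.proj x))) < ρ
    rw [hsx, dist_self]
    exact hρ.pos
  obtain ⟨δ, hδ, hball⟩ := Metric.isOpen_iff.1 hopen _ hx
  refine ⟨δ, hδ, fun b hb => ?_⟩
  obtain ⟨γ, hlen, hγ⟩ := hgeo.exists_path (U.proj x) b
  have hmem : ∀ t, γ t ∈ e.target ∩ e.symm ⁻¹' {y | dist (F x) (F y) < ρ} := fun t =>
    hball (by rw [Metric.mem_ball, dist_comm]; exact (hγ t).trans_lt hb)
  have hps : ∀ t, U.proj (e.symm (γ t)) = γ t := fun t => by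
    rw [← hpe', e.right_inv (hmem t).1]
  let Γ : Path x (e.symm b) :=
    { toFun := fun t => e.symm (γ t)
      continuous_toFun := e.continuousOn_symm.comp_continuous γ.continuous fun t => (hmem t).1
      source' := by simp [hsx]
      target' := by simp }
  refine ⟨e.symm b, by simpa using hps 1, ?_, fun g => ?_⟩
  · refine (U.lengthDist_le_curveLength Γ).trans ?_
    rwa [show U.proj ∘ Γ = γ from funext hps]
  · obtain ⟨Δ, hΔ⟩ := U.exists_baseleaf_path hG
      (c := fun t => f (U.baseleafMap (g • Γ t)))
      (f.continuous.comp (U.continuous_baseleafMap.comp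
        ((U.continuous_smul g).comp Γ.continuous)))
      (y := r (g • x)) (y' := r (g • e.symm b)) (by rw [hr]; simp) (by rw [hr]; simp)
    have hpΔ : ∀ t, U.proj (Δ t) = F (Γ t) (cosetsOf g) := fun t => by
      rw [← solenoidProj_baseleafMap, hΔ, hF]
    have hclose : ∀ t, dist (U.proj (r (g • x))) (U.proj (Δ t)) < ρ := fun t => by
      have h0 : U.proj (r (g • x)) = F x (cosetsOf g) := by
        simpa using hpΔ 0
      rw [h0, hpΔ]
      exact (ContinuousMap.dist_apply_le_dist _).trans_lt (hmem t).2
    refine (hρ.lengthDist_le hgeo Δ hclose).trans ?_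
    rw [edist_dist]
    exact ENNReal.ofReal_le_ofReal (by simpa using (hclose 1).le)

variable [CompactSpace X]

/-- A path from `x` to `y` may have infinite length. The displacement bound, for a family constant
in the coset variable, in effect replaces it by finitely many lifted geodesics. -/
theorem lengthDist_ne_top (hgeo : IsGeodesicMetricSpace X)
    (hG : Group.ResiduallyFinite (FundamentalGroup X x₀)) (x y : U.Space) :
    U.lengthDist x y ≠ ∞ := by
  obtain ⟨ρ, hρ⟩ := U.exists_isLiftRadius
  obtain ⟨C, hC⟩ := hρ.exists_displacement_bound hgeo hG
    (c := fun q => U.baseleafMap (PathConnectedSpace.somePath x y q.1))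
    (U.continuous_baseleafMap.comp ((Path.continuous _).comp continuous_fst))
  exact ((hC 1 x y (by simp) (by simp)).trans_lt ENNReal.coe_lt_top).ne

/-- A restriction to the baseleaf moves the translates of the ends of a path a uniformly bounded
distance apart. -/
theorem IsBaseleafRestriction.exists_orbit_bound (hgeo : IsGeodesicMetricSpace X)
    (hG : Group.ResiduallyFinite (FundamentalGroup X x₀)) {f : C(U.Solenoid, U.Solenoid)}
    {r : U.Space → U.Space} (hr : U.IsBaseleafRestriction f r) (x y : U.Space) :
    ∃ C : ℝ≥0, ∀ g : FundamentalGroup X x₀, U.lengthDist (r (g • x)) (r (g • y)) ≤ C := by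
  obtain ⟨ρ, hρ⟩ := U.exists_isLiftRadius
  obtain ⟨C, hC⟩ := hρ.exists_displacement_bound hgeo hG
    (c := fun q => f (U.solenoidSMul q.2 (PathConnectedSpace.somePath x y q.1)))
    (f.continuous.comp (U.continuous_solenoidSMul.comp
      (continuous_snd.prodMk ((Path.continuous _).comp continuous_fst))))
  refine ⟨C, fun g => hC g _ _ ?_ ?_⟩
  · rw [hr]; simp
  · rw [hr]; simp

/-- Every point is close to an orbit point whose image under a restriction to the baseleaf is close
to the image of the point. -/
theorem IsBaseleafRestriction.exists_near_orbit (hgeo : IsGeodesicMetricSpace X)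
    (hG : Group.ResiduallyFinite (FundamentalGroup X x₀)) {f : C(U.Solenoid, U.Solenoid)}
    {r : U.Space → U.Space} (hr : U.IsBaseleafRestriction f r) :
    ∃ C : ℝ≥0, ∀ z, ∃ g : FundamentalGroup X x₀, U.lengthDist z (g • U.base) ≤ C ∧
      U.lengthDist (r z) (r (g • U.base)) ≤ C := by
  obtain ⟨ρ, hρ⟩ := U.exists_isLiftRadius
  have hlocal : ∀ c : X, ∃ V ∈ nhds c, ∃ B : ℝ≥0, ∀ z, U.proj z ∈ V →
      ∃ g : FundamentalGroup X x₀, U.lengthDist z (g • U.base) ≤ B ∧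
        U.lengthDist (r z) (r (g • U.base)) ≤ B := fun c => by
    obtain ⟨x, rfl, -⟩ := U.exists_proj_eq_lengthDist_le hgeo U.base c
    obtain ⟨δ, hδ, h⟩ := hr.exists_local_bound hρ hgeo hG x
    obtain ⟨C, hC⟩ := hr.exists_orbit_bound hgeo hG x U.base
    lift U.lengthDist x U.base to ℝ≥0 using lengthDist_ne_top hgeo hG _ _ with C' hC'
    refine ⟨_, Metric.ball_mem_nhds _ hδ,
      (δ.toNNReal + C') + (ρ.toNNReal + C), fun z hz => ?_⟩
    rw [Metric.mem_ball, dist_comm] at hz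
    obtain ⟨y, hy, hd, hb⟩ := h _ hz
    -- The point is now `g • y`, and it is compared with the orbit point of the same `g` by way of
    -- `g • x`; the constants depend on `x` only.
    obtain ⟨g, rfl⟩ := U.exists_smul_eq hy
    refine ⟨g, ?_, ?_⟩
    · rw [U.lengthDist_smul]
      refine (U.lengthDist_triangle _ x _).trans (le_trans (b := ((δ.toNNReal + C' : ℝ≥0) : ℝ≥0∞))
        ?_ (by exact_mod_cast le_self_add))
      push_cast
      rw [hC', U.lengthDist_comm y]
      refine add_le_add_left (hd.trans ?_) _
      rw [edist_dist]
      exact ENNReal.ofReal_le_ofReal hz.le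
    · refine (U.lengthDist_triangle _ (r (g • x)) _).trans
        (le_trans (b := ((ρ.toNNReal + C : ℝ≥0) : ℝ≥0∞)) ?_ (by exact_mod_cast le_add_self))
      push_cast
      refine add_le_add ?_ (hC g)
      rw [U.lengthDist_comm]
      exact hb g
  choose V hV B hB using hlocal
  obtain ⟨t, -, ht⟩ := isCompact_univ.elim_nhds_subcover V fun c _ => hV c
  refine ⟨t.sup B, fun z => ?_⟩
  obtain ⟨c, hc, hz⟩ := Set.mem_iUnion₂.1 (ht (Set.mem_univ (U.proj z)))
  obtain ⟨g, h1, h2⟩ := hB c z hz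
  have hle : (B c : ℝ≥0∞) ≤ (t.sup B : ℝ≥0) := by exact_mod_cast Finset.le_sup hc
  exact ⟨g, h1.trans hle, h2.trans hle⟩

end UniversalCover

theorem Set.Finite.exists_ennreal_bound {α : Type*} {E : Set α} (hE : E.Finite) {φ : α → ℝ≥0∞}
    (hφ : ∀ s ∈ E, φ s ≠ ∞) : ∃ M : ℝ≥0, ∀ s ∈ E, φ s ≤ M := by
  refine ⟨hE.toFinset.sup fun s => (φ s).toNNReal, fun s hs => ?_⟩
  rw [← ENNReal.coe_toNNReal (hφ s hs)]
  exact_mod_cast Finset.le_sup (f := fun s => (φ s).toNNReal) (hE.mem_toFinset.2 hs)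

/-! ### Word metrics -/

section WordMetric

variable {G : Type u} [Group G] (S : Set G)

theorem wordLength_one : wordLength S (1 : G) = 0 :=
  le_antisymm (iInf_le_of_le ⟨[], by simp, by simp⟩ (by simp)) zero_le

theorem wordLength_mul_le (g h : G) :
    wordLength S (g * h) ≤ wordLength S g + wordLength S h := by
  refine ENNReal.le_iInf_add_iInf fun l m => ?_
  refine iInf_le_of_le ⟨l.1 ++ m.1, ?_, ?_⟩ (by simp)
  · intro s hs
    rcases List.mem_append.1 hs with hs | hs
    exacts [l.2.1 s hs, m.2.1 s hs]
  · rw [List.prod_append, l.2.2, m.2.2]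

theorem wordLength_le_one {s : G} (hs : s ∈ S) : wordLength S s ≤ 1 :=
  iInf_le_of_le ⟨[s], by simpa using Or.inl hs, by simp⟩ (by simp)

theorem wordLength_ne_top_iff {g : G} : wordLength S g ≠ ∞ ↔ g ∈ Subgroup.closure S := by
  constructor
  · intro h
    obtain ⟨⟨l, hl, rfl⟩, -⟩ := iInf_lt_iff.1 (lt_top_iff_ne_top.2 h)
    refine Subgroup.list_prod_mem _ fun s hs => ?_
    rcases hl s hs with h | h
    · exact Subgroup.subset_closure h
    · exact (Subgroup.inv_mem_iff _).1 (Subgroup.subset_closure h)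
  · intro h
    induction h using Subgroup.closure_induction with
    | mem s hs => exact ((wordLength_le_one S hs).trans_lt ENNReal.one_lt_top).ne
    | one => simp [wordLength_one]
    | mul g h _ _ hg hh =>
      exact ((wordLength_mul_le S g h).trans_lt (ENNReal.add_lt_top.2
        ⟨lt_top_iff_ne_top.2 hg, lt_top_iff_ne_top.2 hh⟩)).ne
    | inv g _ hg => exact ((wordLength_inv_le S g).trans_lt (lt_top_iff_ne_top.2 hg)).ne

/-- A word for `g⁻¹ * k` is an edge path from `g` to `k` in the Cayley graph, and each edge, in
either direction, costs at most `C`. -/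
theorem edist_le_mul_of_generators (hS : Subgroup.closure S = ⊤) {β : Type v}
    [PseudoEMetricSpace β]
    (φ : G → β) (C : ℝ≥0)
    (h : ∀ (g s : G), s ∈ S → edist (φ g) (φ (g * s)) ≤ C) (g k : G) :
    edist (φ g) (φ k) ≤ C * wordLength S (g⁻¹ * k) := by
  have key : ∀ (l : List G) (g : G), (∀ s ∈ l, s ∈ S ∨ s⁻¹ ∈ S) →
      edist (φ g) (φ (g * l.prod)) ≤ C * (l.length : ℝ≥0∞) := by
    intro l
    induction l with
    | nil => intro g _; simp
    | cons s l ih =>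
      intro g hl
      have h1 : edist (φ g) (φ (g * s)) ≤ C := by
        rcases hl s (by simp) with hs | hs
        · exact h g s hs
        · have := h (g * s) s⁻¹ hs
          rw [mul_inv_cancel_right] at this
          rwa [edist_comm]
      have h2 := ih (g * s) fun t ht => hl t (by simp [ht])
      rw [List.prod_cons, ← mul_assoc]
      refine (edist_triangle _ (φ (g * s)) _).trans ((add_le_add h1 h2).trans_eq ?_)
      push_cast [List.length_cons]
      ring
  -- Generation makes the set of words nonempty; over an empty set, multiplication by `C = 0` would
  -- not commute with the infimum.
  have hmem : g⁻¹ * k ∈ Subgroup.closure S := hS ▸ Subgroup.mem_top _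
  obtain ⟨l₀, -⟩ := iInf_lt_iff.1 (lt_top_iff_ne_top.2 ((wordLength_ne_top_iff S).2 hmem))
  have : Nonempty {l : List G // (∀ s ∈ l, s ∈ S ∨ s⁻¹ ∈ S) ∧
    l.prod = g⁻¹ * k} := ⟨l₀⟩
  rw [wordLength, ENNReal.mul_iInf (by simp)]
  refine le_iInf fun l => ?_
  have := key l.1 g l.2.1
  rwa [l.2.2, mul_inv_cancel_left] at this

end WordMetric

namespace UniversalCover

variable {X : Type u} [MetricSpace X] {x₀ : X} {U : UniversalCover.{u, v} X x₀}

/-! ### The orbit map is a quasi-isometry -/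

/-- This is total boundedness of balls in X̃, by induction on the radius. A point `z` is within `ε`
of some `w` in the smaller ball, `w` of an old centre `a`, and `z` of a lift `y` of a point of a
finite net of `X`; so `y` is within `3 * ε` of `a`. Only finitely many such `y` occur, because two
over the same net point are at distance at most `6 * ε < ρ` and coincide. -/
theorem IsLiftRadius.exists_finite_cover [CompactSpace X] {ρ ε : ℝ} (hρ : U.IsLiftRadius ρ)
    (hgeo : IsGeodesicMetricSpace X) (hε : 0 < ε) (hερ : 6 * ε < ρ) (n : ℕ) :
    ∃ A : Set U.Space, A.Finite ∧ ∀ z, U.lengthDist z U.base < n * ENNReal.ofReal ε →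
      ∃ a ∈ A, U.lengthDist z a ≤ ENNReal.ofReal ε := by
  obtain ⟨N, -, hNfin, hN⟩ := (isCompact_univ (X := X)).finite_cover_balls hε
  induction n with
  | zero => exact ⟨∅, Set.finite_empty, fun z hz => by simp at hz⟩
  | succ n ih =>
    obtain ⟨A, hA, hAn⟩ := ih
    refine ⟨insert U.base (⋃ a ∈ A, {y | U.proj y ∈ N ∧
      U.lengthDist y a ≤ ENNReal.ofReal (3 * ε)}), ?_, fun z hz => ?_⟩
    · refine (hA.biUnion fun a _ => ?_).insert _
      refine Set.Finite.of_injOn (f := U.proj) (fun y hy => hy.1) (fun y hy y' hy' hyy' => ?_) hNfin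
      refine hρ.eq_of_lengthDist_lt ((U.lengthDist_triangle y a y').trans_lt ?_) hyy'
      rw [U.lengthDist_comm a]
      refine (add_le_add hy.2 hy'.2).trans_lt ?_
      rw [← ENNReal.ofReal_add (by positivity) (by positivity),
        ENNReal.ofReal_lt_ofReal_iff hρ.pos]
      linarith
    · obtain ⟨γ, hγ⟩ := U.exists_path_of_lengthDist_lt hz
      rcases hρ.exists_step hgeo hε (by linarith) γ with h1 | ⟨w, h1, h2⟩
      · exact ⟨U.base, Set.mem_insert _ _, h1⟩
      · have h3 : ENNReal.ofReal ε + U.lengthDist w U.base <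
            ENNReal.ofReal ε + n * ENNReal.ofReal ε := by
          refine (h2.trans_lt hγ).trans_eq ?_
          push_cast
          ring
        obtain ⟨a, ha, hwa⟩ := hAn w ((ENNReal.add_lt_add_iff_left ENNReal.ofReal_ne_top).1 h3)
        obtain ⟨b, hb, hzb⟩ := Set.mem_iUnion₂.1 (hN (Set.mem_univ (U.proj z)))
        obtain ⟨y, rfl, hzy⟩ := U.exists_proj_eq_lengthDist_le hgeo z b
        have hzy' : U.lengthDist z y ≤ ENNReal.ofReal ε := by
          refine hzy.trans ?_
          rw [edist_dist]
          exact ENNReal.ofReal_le_ofReal (Metric.mem_ball.1 hzb).le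
        refine ⟨y, Set.mem_insert_of_mem _ (Set.mem_biUnion ha ⟨hb, ?_⟩), hzy'⟩
        calc U.lengthDist y a ≤ U.lengthDist y z + (U.lengthDist z w + U.lengthDist w a) :=
              (U.lengthDist_triangle y z a).trans
                (add_le_add_right (U.lengthDist_triangle z w a) _)
          _ ≤ ENNReal.ofReal ε + (ENNReal.ofReal ε + ENNReal.ofReal ε) := by
              rw [U.lengthDist_comm y]
              gcongr
          _ = ENNReal.ofReal (3 * ε) := by
              rw [← ENNReal.ofReal_add hε.le hε.le, ← ENNReal.ofReal_add hε.le (by positivity)]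
              congr 1
              ring

theorem exists_orbit_near [CompactSpace X] (hgeo : IsGeodesicMetricSpace X) :
    ∃ R : ℝ≥0, ∀ z : U.Space, ∃ g : FundamentalGroup X x₀, U.lengthDist z (g • U.base) ≤ R := by
  obtain ⟨R, hR⟩ := Metric.isBounded_iff.1 (isCompact_univ (X := X)).isBounded
  refine ⟨R.toNNReal, fun z => ?_⟩
  obtain ⟨y, hy, hd⟩ := U.exists_proj_eq_lengthDist_le hgeo z (U.proj U.base)
  obtain ⟨g, rfl⟩ := U.exists_smul_eq hy.symm
  refine ⟨g, hd.trans ?_⟩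
  rw [edist_dist]
  exact ENNReal.ofReal_le_ofReal (hR (Set.mem_univ _) (Set.mem_univ _))

/-- The action is metrically proper: a ball is covered by finitely many small ones, and each
contains at most one orbit point because fibres are `ρ`-separated. -/
theorem finite_setOf_lengthDist_le [CompactSpace X] (hgeo : IsGeodesicMetricSpace X)
    (L : ℝ≥0) :
    {g : FundamentalGroup X x₀ | U.lengthDist (g • U.base) U.base ≤ L}.Finite := by
  obtain ⟨ρ, hρ⟩ := U.exists_isLiftRadius
  have hε : 0 < ρ / 7 := by have := hρ.pos; positivity
  obtain ⟨n, hn⟩ := exists_nat_gt ((L : ℝ) / (ρ / 7))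
  rw [div_lt_iff₀ hε] at hn
  obtain ⟨A, hA, h⟩ := hρ.exists_finite_cover hgeo hε (by linarith) n
  refine (hA.biUnion (t := fun a => {g : FundamentalGroup X x₀ |
    U.lengthDist (g • U.base) a ≤ ENNReal.ofReal (ρ / 7)}) fun a _ => ?_).subset fun g hg => ?_
  · refine Set.Subsingleton.finite fun g hg g' hg' => ?_
    have hgg : g • U.base = g' • U.base := by
      refine hρ.eq_of_lengthDist_lt ((U.lengthDist_triangle _ a _).trans_lt ?_) (by simp)
      rw [U.lengthDist_comm a]
      refine (add_le_add hg hg').trans_lt ?_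
      rw [← ENNReal.ofReal_add hε.le hε.le, ENNReal.ofReal_lt_ofReal_iff hρ.pos]
      linarith [hρ.pos]
    have : (g'⁻¹ * g) • U.base = U.base := by rw [mul_smul, hgg, inv_smul_smul]
    exact (inv_mul_eq_one.1 (U.eq_one_of_smul_eq this)).symm
  · obtain ⟨a, ha, hga⟩ := h (g • U.base) (lt_of_le_of_lt hg (by
      rw [← ENNReal.ofReal_natCast, ← ENNReal.ofReal_mul (Nat.cast_nonneg n),
        ← ENNReal.ofReal_coe_nnreal]
      exact (ENNReal.ofReal_lt_ofReal_iff (L.2.trans_lt hn)).2 hn))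
    exact Set.mem_biUnion ha hga

variable [LocallyPathConnectedSpace X]

/-- The lower bound in the Švarc–Milnor lemma. -/
theorem exists_wordLength_bound [CompactSpace X] (hgeo : IsGeodesicMetricSpace X) :
    ∃ (E : Set (FundamentalGroup X x₀)) (ε : ℝ), E.Finite ∧ 0 < ε ∧
      ∀ (S : Set (FundamentalGroup X x₀)) (M : ℝ≥0), (∀ s ∈ E, wordLength S s ≤ M) →
      ∀ (g : FundamentalGroup X x₀) (m : ℕ),
        U.lengthDist U.base (g • U.base) < m * ENNReal.ofReal ε →
        wordLength S g ≤ (m + 2) * M := by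
  obtain ⟨ρ, hρ⟩ := U.exists_isLiftRadius
  have hε : 0 < ρ / 2 := by have := hρ.pos; positivity
  obtain ⟨R, hR⟩ := exists_orbit_near (U := U) hgeo
  -- `E` contains `a⁻¹ * b` whenever the orbit points of `a` and `b` are within `R` of two
  -- consecutive points of a chain. It is fixed before `S`, so that `S = E` can give finite
  -- generation and a generating `S` the quasi-isometry bound.
  refine ⟨_, ρ / 2, finite_setOf_lengthDist_le (U := U) hgeo (R + (ρ / 2).toNNReal + R), hε,
    fun S M hM g m hg => ?_⟩
  obtain ⟨z, hz0, hzm, hz⟩ := hρ.exists_chain hgeo hε (by linarith) m hg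
  choose k hk using hR
  have hstep : ∀ (a b : FundamentalGroup X x₀) (y y' : U.Space),
      U.lengthDist y (a • U.base) ≤ R → U.lengthDist y' (b • U.base) ≤ R →
      U.lengthDist y y' ≤ ENNReal.ofReal (ρ / 2) → wordLength S (a⁻¹ * b) ≤ M := by
    intro a b y y' ha hb hy
    refine hM _ ?_
    change U.lengthDist _ _ ≤ _
    rw [← U.lengthDist_smul a, smul_smul, mul_inv_cancel_left, U.lengthDist_comm]
    push_cast
    rw [U.lengthDist_comm] at ha
    exact (U.lengthDist_triangle _ y' _).trans (add_le_add
      ((U.lengthDist_triangle _ y _).trans (add_le_add ha hy)) hb)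
  -- The extra summand is the step from `1` to `k (z 0)`; the last step, from `k (z m)` to `g`,
  -- later makes the total `m + 2`.
  have hsum : ∀ i ≤ m, wordLength S (k (z i)) ≤ (i + 1) * M := by
    intro i
    induction i with
    | zero =>
      intro _
      have := hstep 1 (k (z 0)) U.base (z 0) (by
        rw [one_smul, U.lengthDist_self]
        exact zero_le) (hk _) (by
        rw [hz0, U.lengthDist_self]
        exact zero_le)
      rw [inv_one, one_mul] at this
      simpa only [Nat.cast_zero, zero_add, one_mul] using this
    | succ i ih =>
      intro hi
      have h1 := hstep (k (z i)) (k (z (i + 1))) _ _ (hk _) (hk _) (hz i hi)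
      have h2 := wordLength_mul_le S (k (z i)) ((k (z i))⁻¹ * k (z (i + 1)))
      rw [mul_inv_cancel_left] at h2
      refine h2.trans ((add_le_add (ih (by omega)) h1).trans_eq ?_)
      push_cast
      ring
  have h1 := hstep (k (z m)) g (z m) (g • U.base) (hk _) (by
    rw [U.lengthDist_self]
    exact zero_le) (by
    rw [hzm, U.lengthDist_self]
    exact zero_le)
  have h2 := wordLength_mul_le S (k (z m)) ((k (z m))⁻¹ * g)
  rw [mul_inv_cancel_left] at h2
  refine h2.trans ((add_le_add (hsum m le_rfl) h1).trans_eq ?_)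
  ring

/-- For `S = E` and `M = 1` the word length bound is finite at every `g`, since distances in X̃ are
finite. -/
theorem fundamentalGroup_fg [CompactSpace X] (U : UniversalCover.{u, v} X x₀)
    (hgeo : IsGeodesicMetricSpace X) (hG : Group.ResiduallyFinite (FundamentalGroup X x₀)) :
    Group.FG (FundamentalGroup X x₀) := by
  obtain ⟨E, ε, hE, hε, h⟩ := exists_wordLength_bound (U := U) hgeo
  refine Group.fg_iff.2 ⟨E, ?_, hE⟩
  refine (Subgroup.eq_top_iff' _).2 fun g => (wordLength_ne_top_iff E).1 ?_
  obtain ⟨m, hm⟩ := ENNReal.exists_nat_mul_gt (ENNReal.ofReal_pos.2 hε).ne'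
    (lengthDist_ne_top hgeo hG U.base (g • U.base))
  exact ((h E 1 (fun s hs => wordLength_le_one E hs) g m hm).trans_lt (by
    norm_cast; exact ENNReal.coe_lt_top)).ne

variable (U) in
theorem isQuasiIsometry_orbitMap [CompactSpace X] (hgeo : IsGeodesicMetricSpace X)
    (hG : Group.ResiduallyFinite (FundamentalGroup X x₀)) {S : Set (FundamentalGroup X x₀)}
    (hS : S.Finite) (hgen : Subgroup.closure S = ⊤) : IsQuasiIsometry (U.orbitMap S) := by
  obtain ⟨E, ε, hE, hε, h⟩ := exists_wordLength_bound (U := U) hgeo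
  obtain ⟨R, hR⟩ := exists_orbit_near (U := U) hgeo
  obtain ⟨M, hM⟩ : ∃ M : ℝ≥0, ∀ s ∈ E, wordLength S s ≤ M := by
    refine hE.exists_ennreal_bound fun s _ => (wordLength_ne_top_iff S).2 ?_
    rw [hgen]
    trivial
  obtain ⟨C, hC⟩ : ∃ C : ℝ≥0, ∀ s ∈ S, U.lengthDist U.base (s • U.base) ≤ C :=
    hS.exists_ennreal_bound fun s _ => lengthDist_ne_top hgeo hG _ _
  have hlower : ∀ g k : WordMetrized S,
      edist g k ≤ (M * (ε⁻¹).toNNReal : ℝ≥0) * edist (U.orbitMap S g) (U.orbitMap S k) +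
        (3 * M : ℝ≥0) := fun g k => by
    change wordLength S ((show FundamentalGroup X x₀ from g)⁻¹ *
      (show FundamentalGroup X x₀ from k)) ≤ _ * U.lengthDist _ _ + _
    have hd : U.lengthDist (U.orbitMap S g) (U.orbitMap S k) = U.lengthDist U.base
        (((show FundamentalGroup X x₀ from g)⁻¹ * (show FundamentalGroup X x₀ from k)) •
          U.base) := by
      rw [← U.lengthDist_smul (show FundamentalGroup X x₀ from g) U.base, smul_smul,
        mul_inv_cancel_left]
      rfl
    rw [hd]
    generalize (show FundamentalGroup X x₀ from g)⁻¹ * (show FundamentalGroup X x₀ from k) = a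
    have ha := lengthDist_ne_top hgeo hG U.base (a • U.base)
    have hbound := h S M hM a
    lift U.lengthDist U.base (a • U.base) to ℝ≥0 using ha with D
    -- The number of chain steps is `⌊D / ε⌋ + 1`, as the bound needs a strict inequality; with the
    -- two end steps this gives the additive constant `3 * M`.
    have hlt : (D : ℝ) < (⌊(D : ℝ) * ε⁻¹⌋₊ + 1 : ℕ) * ε := by
      rw [← div_lt_iff₀ hε, div_eq_mul_inv]
      exact_mod_cast Nat.lt_floor_add_one _
    refine (hbound (⌊(D : ℝ) * ε⁻¹⌋₊ + 1) ?_).trans ?_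
    · rw [← ENNReal.ofReal_natCast, ← ENNReal.ofReal_mul (Nat.cast_nonneg _),
        ← ENNReal.ofReal_coe_nnreal]
      exact (ENNReal.ofReal_lt_ofReal_iff (by positivity)).2 hlt
    · have hfl : (⌊(D : ℝ) * ε⁻¹⌋₊ : ℝ≥0) ≤ D * (ε⁻¹).toNNReal := by
        rw [← NNReal.coe_le_coe]
        push_cast
        rw [Real.coe_toNNReal _ (by positivity)]
        exact Nat.floor_le (by positivity)
      norm_cast
      push_cast
      calc ((⌊(D : ℝ) * ε⁻¹⌋₊ : ℝ≥0) + 1 + 2) * M ≤ (D * (ε⁻¹).toNNReal + 1 + 2) * M := by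
            gcongr
        _ = _ := by ring
  have hupper : ∀ g k : WordMetrized S,
      edist (U.orbitMap S g) (U.orbitMap S k) ≤ C * edist g k :=
    edist_le_mul_of_generators S hgen (U.orbitMap S) C fun g s hs => by
      change U.lengthDist (g • U.base) ((g * s) • U.base) ≤ C
      rw [mul_smul, U.lengthDist_smul]
      exact hC s hs
  refine IsQuasiIsometry.mk' (M * (ε⁻¹).toNNReal + C) (3 * M) 0 R (fun g k => (hlower g k).trans ?_)
    (fun g k => (hupper g k).trans ?_)
    fun y => ?_
  · push_cast
    gcongr
    exact le_self_add
  · push_cast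
    rw [add_zero]
    gcongr
    exact le_add_self
  obtain ⟨g, hg⟩ := hR y
  exact ⟨g, (U.lengthDist_comm _ _).trans_le hg⟩

end UniversalCover

/-! ### Quasi-isometry groups of quasi-isometric spaces -/

section QuasiIsometry

variable {α : Type u} {β : Type v} {δ : Type w} [PseudoEMetricSpace α] [PseudoEMetricSpace β]

theorem QI.mk_eq_mk_iff {a a' : QIMaps α} :
    QI.mk a = QI.mk a' ↔ AtBoundedDistance (a.1 : α → α) a'.1 :=
  Con.eq _

theorem IsQuasiIsometry.atBoundedDistance_comp {f : α → β} (hf : IsQuasiIsometry f)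
    {g g' : δ → α} (h : AtBoundedDistance g g') :
    AtBoundedDistance (fun x => f (g x)) (fun x => f (g' x)) := by
  obtain ⟨D, hD⟩ := h
  obtain ⟨K, C, -, -, -, h2, -⟩ := hf
  refine ⟨K * D + C, fun x => (h2 _ _).trans ?_⟩
  push_cast
  gcongr
  exact hD x

theorem AtBoundedDistance.comp_right {ι : Type*} {f f' : ι → β} (h : AtBoundedDistance f f') (g : δ → ι) :
    AtBoundedDistance (fun x => f (g x)) (fun x => f' (g x)) := by
  obtain ⟨D, hD⟩ := h
  exact ⟨D, fun x => hD (g x)⟩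

theorem AtBoundedDistance.trans {f g h : δ → β} (h₁ : AtBoundedDistance f g)
    (h₂ : AtBoundedDistance g h) : AtBoundedDistance f h :=
  AtBoundedDistance.equivalence.trans h₁ h₂

theorem AtBoundedDistance.symm {f g : δ → β} (h : AtBoundedDistance f g) :
    AtBoundedDistance g f :=
  AtBoundedDistance.equivalence.symm h

/-- A quasi-isometry induces an isomorphism of quasi-isometry groups. -/
theorem IsQuasiIsometry.exists_mulEquiv {o : β → α} (ho : IsQuasiIsometry o) :
    ∃ Φ : QI α ≃* QI β, ∀ (a : QIMaps α) (b : QIMaps β),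
      Φ (QI.mk a) = QI.mk b ↔ AtBoundedDistance (fun g => a.1 (o g)) (fun g => o (b.1 g)) := by
  obtain ⟨o', ho', h1, h2⟩ := ho.exists_inverse
  let conj (a : QIMaps α) : QIMaps β :=
    ⟨fun g => o' (a.1 (o g)), IsQuasiIsometry.comp ho' (IsQuasiIsometry.comp (g := a.1) a.2 ho)⟩
  have hconj : ∀ (a : QIMaps α) (b : QIMaps β), QI.mk (conj a) = QI.mk b ↔
      AtBoundedDistance (fun g => a.1 (o g)) (fun g => o (b.1 g)) := fun a b => by
    rw [QI.mk_eq_mk_iff]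
    constructor
    · intro h
      exact (h2.comp_right fun g => a.1 (o g)).symm.trans (ho.atBoundedDistance_comp h)
    · intro h
      exact (ho'.atBoundedDistance_comp h).trans (h1.comp_right (b.1 : β → β))
  let φ : QIMaps α →* QI β :=
    { toFun := fun a => QI.mk (conj a)
      map_one' := (hconj 1 1).2 (AtBoundedDistance.equivalence.refl _)
      map_mul' := fun a a' => by
        -- The two sides differ by copies of `o ∘ o'`, which is at bounded distance from the
        -- identity.
        refine (hconj (a * a') (conj a * conj a')).2 ?_
        have ha : IsQuasiIsometry (a.1 : α → α) := a.2
        refine (ha.atBoundedDistance_comp (h2.comp_right fun g => a'.1 (o g)).symm).trans ?_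
        exact (h2.comp_right fun g => a.1 (o (o' (a'.1 (o g))))).symm }
  let ψ : QI α →* QI β := (QIMaps.con α).lift φ fun a a' h => by
    have hh : AtBoundedDistance (a.1 : α → α) a'.1 := h
    exact QI.mk_eq_mk_iff.2 (ho'.atBoundedDistance_comp (hh.comp_right o))
  have hψ : ∀ (a : QIMaps α) (b : QIMaps β), ψ (QI.mk a) = QI.mk b ↔
    AtBoundedDistance (fun g => a.1 (o g)) (fun g => o (b.1 g)) := hconj
  refine ⟨MulEquiv.ofBijective ψ ⟨fun x y hxy => ?_, fun y => ?_⟩, hψ⟩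
  · induction x using Con.induction_on with
    | H a =>
    induction y using Con.induction_on with
    | H a' =>
    -- Equal images make `a ∘ o` and `a' ∘ o` close; composing with `o'` on the right recovers `a`
    -- and `a'`.
    have h3 := ((hψ a (conj a')).1 hxy).trans ((hψ a' (conj a')).1 rfl).symm
    have ha : IsQuasiIsometry (a.1 : α → α) := a.2
    have ha' : IsQuasiIsometry (a'.1 : α → α) := a'.2
    exact QI.mk_eq_mk_iff.2 (((ha.atBoundedDistance_comp h2).symm.trans (h3.comp_right o')).trans
      (ha'.atBoundedDistance_comp h2))
  · induction y using Con.induction_on with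
    | H b =>
    have hb : IsQuasiIsometry (b.1 : β → β) := b.2
    refine ⟨QI.mk ⟨fun x => o (b.1 (o' x)), IsQuasiIsometry.comp ho (IsQuasiIsometry.comp hb ho')⟩,
      (hψ _ b).2 ?_⟩
    exact (IsQuasiIsometry.comp ho hb).atBoundedDistance_comp h1

end QuasiIsometry

namespace UniversalCover

variable {X : Type u} [MetricSpace X] [LocallyPathConnectedSpace X] [CompactSpace X] {x₀ : X}
  {U : UniversalCover.{u, v} X x₀}

/-! ### Restrictions to the baseleaf are quasi-isometries -/

/-- On the orbit, the bounds for the finitely many generators, uniform in `g`, make `r` Lipschitz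
for the word metric, which the orbit map compares with the length metric. Other points are replaced
by orbit points through `exists_near_orbit`, which also controls their images under `r`. -/
theorem IsBaseleafRestriction.exists_coarse_lipschitz (hgeo : IsGeodesicMetricSpace X)
    (hG : Group.ResiduallyFinite (FundamentalGroup X x₀)) {f : C(U.Solenoid, U.Solenoid)}
    {r : U.Space → U.Space} (hr : U.IsBaseleafRestriction f r) :
    ∃ K B : ℝ≥0, ∀ x y, U.lengthDist (r x) (r y) ≤ K * U.lengthDist x y + B := by
  obtain ⟨S, hgen, hS⟩ := Group.fg_iff.1 (fundamentalGroup_fg U hgeo hG)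
  obtain ⟨K, A, hK, -, hlow, -, -⟩ := U.isQuasiIsometry_orbitMap hgeo hG hS hgen
  obtain ⟨D, hD⟩ := hr.exists_near_orbit hgeo hG
  choose B hB using fun s : FundamentalGroup X x₀ =>
    hr.exists_orbit_bound hgeo hG U.base (s • U.base)
  obtain ⟨L, hL⟩ := hS.exists_ennreal_bound (φ := fun s => (B s : ℝ≥0∞))
    fun s _ => ENNReal.coe_ne_top
  have horbit : ∀ g h : FundamentalGroup X x₀,
      U.lengthDist (r (g • U.base)) (r (h • U.base)) ≤ L * wordLength S (g⁻¹ * h) :=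
    edist_le_mul_of_generators S hgen
      (fun g : FundamentalGroup X x₀ => show U.Metrized from r (g • U.base)) L fun g s hs => by
        change U.lengthDist (r (g • U.base)) (r ((g * s) • U.base)) ≤ L
        rw [mul_smul]
        exact (hB s g).trans (hL s hs)
  refine ⟨L * K, L * K * (D + D + A) + (D + D), fun x y => ?_⟩
  obtain ⟨g, hg, hrg⟩ := hD x
  obtain ⟨h, hh, hrh⟩ := hD y
  have h1 : wordLength S (g⁻¹ * h) ≤ K * (U.lengthDist (g • U.base) (h • U.base) + A) :=
    IsQuasiIsometry.le_mul hK hlow g h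
  rw [U.lengthDist_comm] at hrh
  have h2 : U.lengthDist (g • U.base) (h • U.base) ≤ D + U.lengthDist x y + D := by
    refine (U.lengthDist_triangle _ y _).trans (add_le_add
      ((U.lengthDist_triangle _ x _).trans (add_le_add_left ?_ _)) hh)
    rwa [U.lengthDist_comm]
  calc U.lengthDist (r x) (r y)
      ≤ (D + L * (K * ((D + U.lengthDist x y + D) + A))) + D := by
        refine (U.lengthDist_triangle _ (r (h • U.base)) _).trans (add_le_add
          ((U.lengthDist_triangle _ (r (g • U.base)) _).trans (add_le_add hrg
            ((horbit g h).trans ?_))) hrh)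
        gcongr
        refine h1.trans ?_
        gcongr
    _ = _ := by
        push_cast
        ring

/-- The tracks of the homotopy from the orbit of the base point form a family over the coset space,
so their displacements are bounded. The coarse Lipschitz bounds carry this from the orbit to all
points. -/
theorem IsBaseleafRestriction.atBoundedDistance (hgeo : IsGeodesicMetricSpace X)
    (hG : Group.ResiduallyFinite (FundamentalGroup X x₀))
    {f f' : C(U.Solenoid, U.Solenoid)} {r r' : U.Metrized → U.Metrized}
    (hr : U.IsBaseleafRestriction f r) (hr' : U.IsBaseleafRestriction f' r')
    (F : f.Homotopy f') : AtBoundedDistance r r' := by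
  obtain ⟨ρ, hρ⟩ := U.exists_isLiftRadius
  obtain ⟨K, B, h⟩ := hr.exists_coarse_lipschitz hgeo hG
  obtain ⟨K', B', h'⟩ := hr'.exists_coarse_lipschitz hgeo hG
  obtain ⟨R, hR⟩ := exists_orbit_near (U := U) hgeo
  obtain ⟨C, hC⟩ := hρ.exists_displacement_bound hgeo hG
    (c := fun q => F (q.1, U.solenoidSMul q.2 U.base))
    (F.continuous.comp (continuous_fst.prodMk (U.continuous_solenoidSMul.comp
      (continuous_snd.prodMk continuous_const))))
  refine ⟨(K * R + B) + C + (K' * R + B'), fun z => ?_⟩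
  obtain ⟨g, hg⟩ := hR z
  have h1 : U.lengthDist (r (g • U.base)) (r' (g • U.base)) ≤ C :=
    hC g _ _ (by rw [hr]; simp) (by rw [hr']; simp)
  push_cast
  refine (U.lengthDist_triangle (r z) (r' (g • U.base)) (r' z)).trans (add_le_add
    ((U.lengthDist_triangle (r z) (r (g • U.base)) _).trans (add_le_add ?_ h1)) ?_)
  · refine (h z _).trans ?_
    gcongr
  · refine (h' _ z).trans ?_
    gcongr
    exact (U.lengthDist_comm _ _).trans_le hg

/-- Restrictions compose, so the restriction `s` of a homotopy inverse is a coarse inverse of `r`.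
The lower bound for `r` is the upper bound for `s`, and `r ∘ s` close to the identity gives coarse
surjectivity. -/
theorem IsBaseleafRestriction.isQuasiIsometry (hgeo : IsGeodesicMetricSpace X)
    (hG : Group.ResiduallyFinite (FundamentalGroup X x₀))
    (f : HE U.Solenoid U.solenoidBase) {r : U.Metrized → U.Metrized}
    (hr : U.IsBaseleafRestriction f.1.1 r) : IsQuasiIsometry r := by
  obtain ⟨g, ⟨F⟩, ⟨F'⟩⟩ := f.2
  obtain ⟨s, hs⟩ : ∃ s : U.Metrized → U.Metrized, U.IsBaseleafRestriction g.1 s :=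
    U.exists_baseleafRestriction g
  have hid : U.IsBaseleafRestriction (ContinuousMap.id U.Solenoid) (fun x => x) := fun x => rfl
  obtain ⟨D, hD⟩ := IsBaseleafRestriction.atBoundedDistance hgeo hG
    (show U.IsBaseleafRestriction (g.1.comp f.1.1) _ from hs.comp hr) hid F.toHomotopy
  obtain ⟨D', hD'⟩ := IsBaseleafRestriction.atBoundedDistance hgeo hG
    (show U.IsBaseleafRestriction (f.1.1.comp g.1) _ from hr.comp hs) hid F'.toHomotopy
  obtain ⟨K, B, h⟩ := hr.exists_coarse_lipschitz hgeo hG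
  obtain ⟨K', B', h'⟩ := hs.exists_coarse_lipschitz hgeo hG
  refine IsQuasiIsometry.mk' (K + K') (D + B' + D) B D' (fun x y => ?_) (fun x y => ?_)
    fun y => ⟨s y, hD' y⟩
  · calc edist x y ≤ edist x (s (r x)) + edist (s (r x)) (s (r y)) +
          edist (s (r y)) y := edist_triangle4 _ _ _ _
      _ ≤ D + (K' * edist (r x) (r y) + B') + D := by
          refine add_le_add (add_le_add ?_ (h' _ _)) (hD y)
          rw [edist_comm]
          exact hD x
      _ ≤ D + ((K + K') * edist (r x) (r y) + B') + D := by
          gcongr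
          exact le_add_self
      _ = _ := by
          push_cast
          ring
  · refine (h x y).trans ?_
    push_cast
    gcongr
    · exact le_self_add
    · exact le_rfl

variable (U) in
theorem exists_monoidHom (hgeo : IsGeodesicMetricSpace X)
    (hG : Group.ResiduallyFinite (FundamentalGroup X x₀)) :
    ∃ Q : HoMod U.Solenoid U.solenoidBase →* QI U.Metrized,
      ∀ (f : HE U.Solenoid U.solenoidBase) (r : QIMaps U.Metrized),
        U.IsBaseleafRestriction f.1.1 r.1 → Q (HoMod.mk f) = QI.mk r := by
  choose r hr using fun f : HE U.Solenoid U.solenoidBase => U.exists_baseleafRestriction f.1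
  let ρ (f : HE U.Solenoid U.solenoidBase) : QIMaps U.Metrized :=
    ⟨r f, IsBaseleafRestriction.isQuasiIsometry hgeo hG f (hr f)⟩
  -- By uniqueness of restrictions, both homomorphism laws reduce to exhibiting a restriction of `1`
  -- and of `f * f'`.
  have hρ : ∀ (f : HE U.Solenoid U.solenoidBase) (s : QIMaps U.Metrized),
      U.IsBaseleafRestriction f.1.1 s.1 → QI.mk (ρ f) = QI.mk s := fun f s hs =>
    congrArg QI.mk (Subtype.ext ((hr f).eq hG hs))
  let φ : HE U.Solenoid U.solenoidBase →* QI U.Metrized :=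
    { toFun := fun f => QI.mk (ρ f)
      map_one' := hρ 1 1 fun x => rfl
      map_mul' := fun f f' => hρ (f * f') (ρ f * ρ f') ((hr f).comp (hr f')) }
  let Q : HoMod U.Solenoid U.solenoidBase →* QI U.Metrized :=
    (HE.con U.Solenoid U.solenoidBase).lift φ fun f f' h => by
      obtain ⟨F⟩ : f.1.Homotopic f'.1 := h
      exact QI.mk_eq_mk_iff.2
        (IsBaseleafRestriction.atBoundedDistance hgeo hG (hr f) (hr f') F.toHomotopy)
  exact ⟨Q, hρ⟩

end UniversalCover

end

theorem mainTheorem7 {X : Type u} [MetricSpace X] [CompactSpace X] (x₀ : X)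
    (hX : IsUnloopable X) (hgeo : IsGeodesicMetricSpace X)
    (hG : Group.ResiduallyFinite (FundamentalGroup X x₀))
    (U : UniversalCover.{u, v} X x₀) :
    -- every pointed homotopy equivalence restricts to a unique self-map of the universal cover
    (∀ f : HE U.Solenoid U.solenoidBase, ∃! r : U.Space → U.Space,
      U.IsBaseleafRestriction f.1.1 r) ∧
    -- which is a quasi-isometry
    (∀ (f : HE U.Solenoid U.solenoidBase) (r : U.Metrized → U.Metrized),
      U.IsBaseleafRestriction f.1.1 r → IsQuasiIsometry r) ∧
    -- and restriction induces a group homomorphism on pointed homotopy classes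
    (∃ Q : HoMod U.Solenoid U.solenoidBase →* QI U.Metrized,
      ∀ (f : HE U.Solenoid U.solenoidBase) (r : QIMaps U.Metrized),
        U.IsBaseleafRestriction f.1.1 r.1 → Q (HoMod.mk f) = QI.mk r) ∧
    -- the fundamental group is finitely generated and, for each of its word metrics, the orbit map
    -- induces an isomorphism of quasi-isometry groups
    Group.FG (FundamentalGroup X x₀) ∧
    ∀ S : Set (FundamentalGroup X x₀), S.Finite → Subgroup.closure S = ⊤ →
      ∃ Φ : QI U.Metrized ≃* QI (WordMetrized S),
        ∀ (a : QIMaps U.Metrized) (b : QIMaps (WordMetrized S)),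
          Φ (QI.mk a) = QI.mk b ↔
            AtBoundedDistance (fun g => a.1 (U.orbitMap S g)) (fun g => U.orbitMap S (b.1 g)) := by
  have := hX.locallyPathConnected
  refine ⟨fun f => ?_, fun f r hr => UniversalCover.IsBaseleafRestriction.isQuasiIsometry
    hgeo hG f hr, U.exists_monoidHom hgeo hG, UniversalCover.fundamentalGroup_fg U hgeo hG,
    fun S hS hgen => (U.isQuasiIsometry_orbitMap hgeo hG hS hgen).exists_mulEquiv⟩
  obtain ⟨r, hr⟩ := U.exists_baseleafRestriction f.1
  exact ⟨r, hr, fun r' hr' => UniversalCover.IsBaseleafRestriction.eq hG hr' hr⟩
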